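/- Let $N,K\ge 1$ be integers, $\rho>0$, and let $(F_n,G_n)_{n\in\mathbb Z}$ be a process of pairs of random complex $N\times K$ matrices on a probability space. Assume that it is stationary and ergodic, that is, the shift on $(\mathbb C^{N\times K}\times\mathbb C^{N\times K})^{\mathbb Z}$ is measure preserving and ergodic for the law of the process, and that $\mathbb E\|F_0\|^2<\infty$ and $\mathbb E\|G_0\|^2<\infty$ (spectral norm). For integers $m\le n$ let $H_{m,n}$ be the $(n-m+1)N\times(n-m+2)K$ block matrix $$H_{m,n}=\begin{bmatrix}F_m&G_m\\&F_{m+1}&G_{m+1}\\&&\ddots&\ddots\\&&&F_n&G_n\end{bmatrix}.$$ (a) There is a stationary process $(W_n)_{n\in\mathbb Z}$ of $K\times K$ Hermitian positive definite matrices, defined on the same probability space, such that almost surely, for all $n\in\mathbb Z$, $$W_n=\bigl(I+\rho\,G_n^*(I+\rho F_nW_{n-1}F_n^*)^{-1}G_n\bigr)^{-1}.$$ It is unique: two such stationary processes coincide almost surely. Moreover $(W_n)$ is ergodic. (b) The mutual information per component $$\mathcal I_\rho=\lim_{n-m\to\infty}\frac{\log\det(I+\rho H_{m,n}H_{m,n}^*)}{(n-m+1)N}\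 \text{ a.s.}\ =\lim_{n-m\to\infty}\frac{\mathbb E\log\det(I+\rho H_{m,n}H_{m,n}^*)}{(n-m+1)N}$$ is well defined: the random variables $\log\det(I+\rho H_{m,n}H_{m,n}^*)$ are integrable, and both limits exist, are finite and are equal. Here the limit of the expectations is taken as $n-m\to\infty$ without any restriction on $m$ and $n$; the almost sure limit is taken as $n-m\to\infty$ with $|m|\le C(n-m)$, for every constant $C$ (this includes $m$ fixed and $n\to\infty$, $n$ fixed and $m\to-\infty$, and $m\to-\infty$, $n\to\infty$ in any manner). Moreover $\log\det(I+\rho F_0W_{-1}F_0^*)$ and $\log\det W_0$ are integrable and $$\mathcal I_\rho=\frac1N\Bigl(\mathbb E\log\det(I+\rho F_0W_{-1}F_0^*)-\mathbb E\log\det W_0\Bigr).$$ (c) For every Hermitian positive semidefinite $K\times K$ matrix $X_{-1}$, if $X_n=\bigl(I+\rho\,G_n^*(I+\rho F_nX_{n-1}F_n^*)^{-1}G_n\bigr)^{-1}$ for all $n\ge0$, then $$\mathcal I_\rho=\lim_{n\to\infty}\frac1{nN}\sum_{\ell=0}^{n-1}\Bigl(\log\det(I+\rho F_\ell X_{\ell-1}F_\ell^*)-\log\det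 X_\ell\Bigr)\quad\text{a.s.}$$ -/

import Mathlib

open MeasureTheory Filter Topology
open scoped Matrix ComplexOrder Matrix.Norms.L2Operator

noncomputable section

namespace ErgodicChannel

/-! ### Two-sided processes: law on path space, stationarity, ergodicity -/

/-- The shift `T` on two-sided sequences, `(T x)_n = x_{n+1}`. -/
def shift (S : Type*) (x : ℤ → S) : ℤ → S := fun n => x (n + 1)

/-- The law of the process `(X_n)_{n ∈ ℤ}` on the path space `S^ℤ`
(with the product `σ`-algebra). -/
def pathLaw {Ω S : Type*} [MeasurableSpace Ω] [MeasurableSpace S]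
    (P : Measure Ω) (X : ℤ → Ω → S) : Measure (ℤ → S) :=
  P.map (fun ω n => X n ω)

/-- A (measurable) process is stationary if the shift preserves its law. -/
structure IsStationaryProcess {Ω S : Type*} [MeasurableSpace Ω] [MeasurableSpace S]
    (P : Measure Ω) (X : ℤ → Ω → S) : Prop where
  measurable : ∀ n, Measurable (X n)
  measurePreserving : MeasurePreserving (shift S) (pathLaw P X) (pathLaw P X)

/-- A (measurable) process is stationary and ergodic if the shift is a measure preserving and
ergodic transformation with respect to its law. -/
structure IsErgodicProcess {Ω S : Type*} [MeasurableSpace Ω] [MeasurableSpace S]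
    (P : Measure Ω) (X : ℤ → Ω → S) : Prop where
  measurable : ∀ n, Measurable (X n)
  ergodic : Ergodic (shift S) (pathLaw P X)

/-! ### The channel -/

/-- Complex `a × b` matrices. -/
abbrev Mat (a b : ℕ) : Type := Matrix (Fin a) (Fin b) ℂ

/-- The Borel `σ`-algebra on complex matrices (the product `σ`-algebra of the entries). -/
instance instMeasurableSpaceMat (a b : ℕ) : MeasurableSpace (Matrix (Fin a) (Fin b) ℂ) :=
  inferInstanceAs (MeasurableSpace (Fin a → Fin b → ℂ))

/-- The channel process is stationary and ergodic, with finite second moments; the norm is the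
spectral norm. -/
structure IsErgodicChannel {Ω : Type*} [MeasurableSpace Ω] {N K : ℕ} (P : Measure Ω)
    (F G : ℤ → Ω → Mat N K) : Prop where
  ergodic : IsErgodicProcess P (fun n ω => (F n ω, G n ω))
  moment_F : Integrable (fun ω => ‖F 0 ω‖ ^ 2) P
  moment_G : Integrable (fun ω => ‖G 0 ω‖ ^ 2) P

/-- `log det A`, used for Hermitian positive definite `A` only, whose determinant is a positive
real number. -/
def logDet {ι : Type*} [Fintype ι] [DecidableEq ι] (A : Matrix ι ι ℂ) : ℝ :=
  Real.log A.det.re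

/-- `I + ρ F W F^*`. -/
def innerMat {N K : ℕ} (ρ : ℝ) (F : Mat N K) (W : Mat K K) : Mat N N :=
  1 + (ρ : ℂ) • (F * W * Fᴴ)

/-- `(I + ρ G^* (I + ρ F W F^*)⁻¹ G)⁻¹`. -/
def recMap {N K : ℕ} (ρ : ℝ) (F G : Mat N K) (W : Mat K K) : Mat K K :=
  (1 + (ρ : ℂ) • (Gᴴ * (innerMat ρ F W)⁻¹ * G))⁻¹

/-- `(W_n)` is a stationary process of positive definite matrices that satisfies the recursion
`W_n = (I + ρ G_n^* (I + ρ F_n W_{n-1} F_n^*)⁻¹ G_n)⁻¹` almost surely. -/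
structure IsStationarySolution {Ω : Type*} [MeasurableSpace Ω] {N K : ℕ} (P : Measure Ω) (ρ : ℝ)
    (F G : ℤ → Ω → Mat N K) (W : ℤ → Ω → Mat K K) : Prop where
  stationary : IsStationaryProcess P W
  posDef : ∀ n ω, (W n ω).PosDef
  recursion : ∀ᵐ ω ∂P, ∀ n, W n ω = recMap ρ (F n ω) (G n ω) (W (n - 1) ω)

/-- The process started from a given matrix: `recursionFrom ρ f g X k` is `X_{k-1}`, where
`X_{-1} = X` and `X_n = (I + ρ g_n^* (I + ρ f_n X_{n-1} f_n^*)⁻¹ g_n)⁻¹` for `n ≥ 0`. -/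
def recursionFrom {N K : ℕ} (ρ : ℝ) (f g : ℤ → Mat N K) (X : Mat K K) : ℕ → Mat K K
  | 0 => X
  | n + 1 => recMap ρ (f n) (g n) (recursionFrom ρ f g X n)

/-! ### The mutual information -/

/-- The block bidiagonal matrix `H_{m,n}` of size `(n-m+1)N × (n-m+2)K` (for `m ≤ n`). The block
rows are numbered by `m, …, n` and the block columns by `m-1, …, n`; block row `i` has `F_i` in
block column `i-1`, `G_i` in block column `i`, and zeros elsewhere. -/
def blockH {N K : ℕ} (f g : ℤ → Mat N K) (m n : ℤ) :
    Matrix (Finset.Icc m n × Fin N) (Finset.Icc (m - 1) n × Fin K) ℂ :=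
  Matrix.of fun r c =>
    if (c.1 : ℤ) = (r.1 : ℤ) - 1 then f r.1 r.2 c.2
    else if (c.1 : ℤ) = (r.1 : ℤ) then g r.1 r.2 c.2
    else 0

/-- `log det (I + ρ H_{m,n} H_{m,n}^*)`. -/
def blockLogDet {N K : ℕ} (ρ : ℝ) (f g : ℤ → Mat N K) (m n : ℤ) : ℝ :=
  logDet (1 + (ρ : ℂ) • (blockH f g m n * (blockH f g m n)ᴴ))

/-- The regime `n - m → ∞` for pairs `p = (m, n)`. -/
def longWindows : Filter (ℤ × ℤ) := comap (fun p => p.2 - p.1) atTop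

/-- `I` is the mutual information per component of the channel: the common value of
* the almost sure limit of `log det (I + ρ H_{m,n} H_{m,n}^*) / ((n - m + 1) N)` as `n - m → ∞`,
  however the window `{m, …, n}` grows, as long as its distance to the origin is at most
  proportional to its length (so `m` fixed and `n → ∞`, or `n` fixed and `m → -∞`, or
  `m → -∞` and `n → ∞` in any manner, are all included);
* the limit of the expectations of the same quantities as `n - m → ∞`, with no restriction. -/
structure IsMutualInformation {Ω : Type*} [MeasurableSpace Ω] {N K : ℕ} (P : Measure Ω) (ρ : ℝ)
    (F G : ℤ → Ω → Mat N K) (I : ℝ) : Prop where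
  ae_tendsto : ∀ᵐ ω ∂P, ∀ C : ℕ,
    Tendsto (fun p : ℤ × ℤ =>
        1 / (((p.2 - p.1 + 1 : ℤ) : ℝ) * N) *
          blockLogDet ρ (fun n => F n ω) (fun n => G n ω) p.1 p.2)
      (longWindows ⊓ 𝓟 {p | |p.1| ≤ C * (p.2 - p.1)}) (𝓝 I)
  integrable : ∀ m n : ℤ, m ≤ n →
    Integrable (fun ω => blockLogDet ρ (fun n => F n ω) (fun n => G n ω) m n) P
  tendsto_expectation :
    Tendsto (fun p : ℤ × ℤ =>
        1 / (((p.2 - p.1 + 1 : ℤ) : ℝ) * N) *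
          ∫ ω, blockLogDet ρ (fun n => F n ω) (fun n => G n ω) p.1 p.2 ∂P)
      longWindows (𝓝 I)

end ErgodicChannel

end

/-!
Write `X ↦ R_n(X)` for the recursion map at time `n`. It is monotone for the Loewner order and maps
positive semidefinite matrices to positive definite matrices `≤ I`.

*The stationary solution.* The recursion started from `I` at time `n - k` gives at time `n` a matrix
that decreases in `k`; its limit `pastLimit` is a solution for every path. If `X ≤ (1 + t) Y` with
`Y ≤ I` and `ρ ‖F_n‖² ≤ c`, then `R_n(X) ≤ (1 + t c / (1 + c)) R_n(Y)` (`recMap_le_smul_recMap`), and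
any two solutions satisfy `W_n ≤ (1 + ρ ‖G_n‖²) W'_n`. By the ergodic theorem the coefficients stay
bounded along a sequence of times tending to `-∞`, which forces two solutions to agree on almost
every path (`solution_le_solution`); neither joint stationarity nor independence of the future is
needed. So every solution is a factor of the channel, hence ergodic.

*The mutual information.* Eliminating the first block of `I + ρ H H^*` by a Schur complement replaces
the diagonal perturbation `X` of the first block by `R_m(X)` in the next one, so that
`log det (I + ρ H_{m,n} H_{m,n}^*)` is the sum of the increments
`log det (I + ρ F_ℓ X_{ℓ-1} F_ℓ^*) - log det X_ℓ` along the trajectory with `X_{m-1} = I`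
(`blockLogDet_eq_sumStep`). The increment is monotone in `X_{ℓ-1}`, because it is
`log det (I + ρ F X F^* + ρ G G^*)`; on the other hand `log det (I + ρ F X F^*) - log det X` is
`log det (X⁻¹ + ρ F^* F)`, which is antitone. Telescoping the two, the sums of increments along the
trajectories of `Y ≤ X` differ by at most `log det X - log det Y`, whatever their length
(`sumStep_sub_le`). Thus all sums in question differ by a bounded cost from the sums of the stationary
increments of the two-sided solution, and Birkhoff's ergodic theorem, applied to the shift and to its
inverse, gives the limits over all admissible windows (`ae_hasWindowMean`). Integrability
follows from `0 ≤ log det (I + ρ F W F^*) ≤ N ρ ‖F‖²` and `0 ≤ -log det W ≤ K ρ ‖G‖²`.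
-/

namespace ErgodicChannel

section Loewner

open scoped MatrixOrder

variable {n m : Type*}

/-! ### The Loewner order, inverses and determinants -/

lemma posDef_of_le {A B : Matrix n n ℂ} (hA : A.PosDef) (hAB : A ≤ B) : B.PosDef := by
  have := hA.add_posSemidef (Matrix.le_iff.mp hAB)
  simpa using this

variable [Fintype n] [Fintype m]

lemma mul_mul_conjTranspose_le {A B : Matrix n n ℂ} (F : Matrix m n ℂ) (hAB : A ≤ B) :
    F * A * Fᴴ ≤ F * B * Fᴴ := by
  have h := (Matrix.le_iff.mp hAB).mul_mul_conjTranspose_same F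
  rw [Matrix.mul_sub, Matrix.sub_mul] at h
  exact Matrix.le_iff.mpr h

lemma mul_mul_conjTranspose_nonneg {A : Matrix n n ℂ} (F : Matrix m n ℂ) (hA : 0 ≤ A) :
    0 ≤ F * A * Fᴴ := by
  simpa using mul_mul_conjTranspose_le F hA

variable [DecidableEq n] [DecidableEq m]

lemma inv_le_inv_of_le {A B : Matrix n n ℂ} (hA : A.PosDef) (hAB : A ≤ B) : B⁻¹ ≤ A⁻¹ := by
  rw [Matrix.nonsing_inv_eq_ringInverse, Matrix.nonsing_inv_eq_ringInverse]
  exact CStarAlgebra.ringInverse_le_ringInverse hAB (Matrix.isStrictlyPositive_iff_posDef.mpr hA)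

lemma inv_le_smul_inv_of_le_smul {A B : Matrix n n ℂ} (hA : A.PosDef) {c : ℝ}
    (hc : 0 < c) (hAB : A ≤ c • B) : B⁻¹ ≤ c • A⁻¹ := by
  have h := inv_le_inv_of_le hA hAB
  have hcB : (c • B)⁻¹ = c⁻¹ • B⁻¹ := by
    have hB : IsUnit B.det := by
      have h1 : (c⁻¹ • (c • B)).PosDef := (posDef_of_le hA hAB).smul (inv_pos.mpr hc)
      rw [smul_smul, inv_mul_cancel₀ hc.ne', one_smul] at h1
      exact (Matrix.isUnit_iff_isUnit_det _).mp h1.isUnit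
    apply Matrix.inv_eq_left_inv
    rw [smul_mul_assoc, mul_smul_comm, smul_smul, inv_mul_cancel₀ hc.ne', one_smul,
      Matrix.nonsing_inv_mul _ hB]
  rw [hcB] at h
  have := smul_le_smul_of_nonneg_left h hc.le
  rwa [smul_smul, mul_inv_cancel₀ hc.ne', one_smul] at this

lemma mul_conjTranspose_le_norm (F : Matrix m n ℂ) :
    F * Fᴴ ≤ (‖F‖ ^ 2) • (1 : Matrix m m ℂ) := by
  have h := IsSelfAdjoint.le_algebraMap_norm_self (a := F * Fᴴ)
    (Matrix.isHermitian_mul_conjTranspose_self F)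
  have h2 : ‖F * Fᴴ‖ = ‖F‖ ^ 2 := by
    have := Matrix.l2_opNorm_conjTranspose_mul_self Fᴴ
    rw [Matrix.conjTranspose_conjTranspose, Matrix.l2_opNorm_conjTranspose] at this
    rw [this, sq]
  rwa [h2, Algebra.algebraMap_eq_smul_one] at h

lemma mul_mul_conjTranspose_le_norm (F : Matrix m n ℂ) {W : Matrix n n ℂ} (hW : W ≤ 1) :
    F * W * Fᴴ ≤ (‖F‖ ^ 2) • (1 : Matrix m m ℂ) := by
  refine (mul_mul_conjTranspose_le F hW).trans ?_
  rw [Matrix.mul_one]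
  exact mul_conjTranspose_le_norm F

lemma det_eq_ofReal {A : Matrix n n ℂ} (hA : A.PosDef) : A.det = (A.det.re : ℂ) := by
  have h := hA.det_pos
  exact Complex.ext rfl (by simpa using (Complex.lt_def.mp h).2.symm)

lemma det_re_pos {A : Matrix n n ℂ} (hA : A.PosDef) : 0 < A.det.re :=
  (Complex.lt_def.mp hA.det_pos).1

lemma det_eq_exp_logDet {A : Matrix n n ℂ} (hA : A.PosDef) :
    A.det = (Real.exp (logDet A) : ℂ) := by
  rw [logDet, Real.exp_log (det_re_pos hA), ← det_eq_ofReal hA]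

lemma logDet_of_det_eq_exp {A : Matrix n n ℂ} {x : ℝ} (h : A.det = (Real.exp x : ℂ)) :
    logDet A = x := by
  rw [logDet, h, Complex.ofReal_re, Real.log_exp]

lemma logDet_of_det_eq_mul {A : Matrix n n ℂ} {B : Matrix m m ℂ} {k : Type*} [Fintype k]
    [DecidableEq k] {C : Matrix k k ℂ} (hB : B.PosDef) (hC : C.PosDef)
    (h : A.det = B.det * C.det) : logDet A = logDet B + logDet C := by
  apply logDet_of_det_eq_exp
  rw [h, det_eq_exp_logDet hB, det_eq_exp_logDet hC, Real.exp_add, Complex.ofReal_mul]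

lemma logDet_one : logDet (1 : Matrix n n ℂ) = 0 := by simp [logDet]

lemma logDet_inv {A : Matrix n n ℂ} (hA : A.PosDef) : logDet A⁻¹ = - logDet A := by
  have h := logDet_of_det_eq_mul (A := (1 : Matrix n n ℂ)) hA hA.inv (by
    rw [← Matrix.det_mul, Matrix.mul_nonsing_inv _
      ((Matrix.isUnit_iff_isUnit_det _).mp hA.isUnit)])
  rw [logDet_one] at h
  linarith

lemma logDet_smul_one {c : ℝ} :
    logDet (c • (1 : Matrix n n ℂ)) = Fintype.card n * Real.log c := by
  have h : (c • (1 : Matrix n n ℂ)).det = ((c ^ Fintype.card n : ℝ) : ℂ) := by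
    have : c • (1 : Matrix n n ℂ) = (c : ℂ) • 1 := by
      ext i j; simp
    rw [this, Matrix.det_smul]; simp
  rw [logDet, h, Complex.ofReal_re, Real.log_pow]

lemma logDet_nonneg {A : Matrix n n ℂ} (hA : 1 ≤ A) : 0 ≤ logDet A := by
  have hP : A.PosDef := posDef_of_le Matrix.PosDef.one hA
  have hH := hP.isHermitian
  have h1 : ∀ i, 1 ≤ hH.eigenvalues i := fun i => by
    have h2 := (algebraMap_le_iff_le_spectrum (R := ℝ) (r := 1) (a := A) hH).mp (by simpa using hA)
    exact h2 _ (hH.eigenvalues_mem_spectrum_real i)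
  apply Real.log_nonneg
  have h3 : A.det = ((∏ i, hH.eigenvalues i : ℝ) : ℂ) := by
    rw [hH.det_eq_prod_eigenvalues]; push_cast; rfl
  rw [h3, Complex.ofReal_re]
  calc (1 : ℝ) = ∏ _i : n, (1 : ℝ) := by simp
    _ ≤ ∏ i, hH.eigenvalues i :=
      Finset.prod_le_prod (fun _ _ => zero_le_one) fun i _ => h1 i

/-- `det (A + DᴴD) = det A · det (1 + D A⁻¹ Dᴴ)`, and the second factor is at least `1`. -/
lemma logDet_le_logDet {A B : Matrix n n ℂ} (hA : A.PosDef) (hAB : A ≤ B) :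
    logDet A ≤ logDet B := by
  obtain ⟨D, hD⟩ := CStarAlgebra.nonneg_iff_eq_star_mul_self.mp (sub_nonneg.mpr hAB)
  have hB : B = A + Dᴴ * D := by
    rw [← Matrix.star_eq_conjTranspose, ← hD]; abel
  have hC : (1 : Matrix n n ℂ) ≤ 1 + D * A⁻¹ * Dᴴ :=
    le_add_of_nonneg_right
      (mul_mul_conjTranspose_nonneg D (Matrix.nonneg_iff_posSemidef.mpr hA.inv.posSemidef))
  have h := logDet_of_det_eq_mul (A := B) hA (posDef_of_le Matrix.PosDef.one hC) (by
    rw [hB, Matrix.det_add_mul _ _ ((Matrix.isUnit_iff_isUnit_det _).mp hA.isUnit)])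
  rw [h]
  linarith [logDet_nonneg hC]

lemma logDet_le_mul {A : Matrix n n ℂ} (hA : A.PosDef) {c : ℝ} (hc : 0 ≤ c)
    (hAc : A ≤ (1 + c) • (1 : Matrix n n ℂ)) : logDet A ≤ Fintype.card n * c := by
  have h := logDet_le_logDet hA hAc
  rw [logDet_smul_one] at h
  refine h.trans (mul_le_mul_of_nonneg_left ?_ (Nat.cast_nonneg _))
  linarith [Real.log_le_sub_one_of_pos (by linarith : 0 < 1 + c)]

/-- The entries of a positive semidefinite matrix are bounded by its trace. -/
lemma norm_apply_le_trace_re {A : Matrix n n ℂ} (hA : 0 ≤ A) (i j : n) :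
    ‖A i j‖ ≤ A.trace.re := by
  obtain ⟨D, rfl⟩ := CStarAlgebra.nonneg_iff_eq_star_mul_self.mp hA
  rw [Matrix.star_eq_conjTranspose]
  have hd : ∀ i, ((Dᴴ * D) i i).re = ∑ k, ‖D k i‖ ^ 2 := fun i => by
    simp only [Matrix.mul_apply, Matrix.conjTranspose_apply, Complex.re_sum]
    refine Finset.sum_congr rfl fun k _ => ?_
    rw [Complex.star_def, ← Complex.normSq_eq_conj_mul_self, Complex.ofReal_re,
      Complex.normSq_eq_norm_sq]
  have ht : (Dᴴ * D).trace.re = ∑ i, ∑ k, ‖D k i‖ ^ 2 := by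
    simp only [Matrix.trace, Matrix.diag, Complex.re_sum, hd]
  have hle : ∀ i, ∑ k, ‖D k i‖ ^ 2 ≤ (Dᴴ * D).trace.re := fun i => by
    rw [ht]
    exact Finset.single_le_sum (f := fun i => ∑ k, ‖D k i‖ ^ 2)
      (fun i _ => Finset.sum_nonneg fun k _ => sq_nonneg _) (Finset.mem_univ i)
  calc ‖(Dᴴ * D) i j‖ ≤ ∑ k, ‖D k i‖ * ‖D k j‖ := by
        rw [Matrix.mul_apply]
        refine (norm_sum_le _ _).trans (le_of_eq (Finset.sum_congr rfl fun k _ => ?_))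
        rw [Matrix.conjTranspose_apply, norm_mul, norm_star]
    _ ≤ ∑ k, (‖D k i‖ ^ 2 + ‖D k j‖ ^ 2) / 2 :=
        Finset.sum_le_sum fun k _ => by nlinarith [sq_nonneg (‖D k i‖ - ‖D k j‖)]
    _ = (∑ k, ‖D k i‖ ^ 2 + ∑ k, ‖D k j‖ ^ 2) / 2 := by
        rw [← Finset.sum_div, Finset.sum_add_distrib]
    _ ≤ (Dᴴ * D).trace.re := by linarith [hle i, hle j]

/-- An antitone sequence of positive semidefinite matrices converges: the entries of the
differences are bounded by the differences of the traces, which converge. -/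
lemma exists_tendsto_of_antitone {A : ℕ → Matrix n n ℂ} (hA : Antitone A) (h0 : ∀ k, 0 ≤ A k) :
    ∃ L, Tendsto A atTop (𝓝 L) := by
  have htr : ∀ k l, k ≤ l → ∀ i j, ‖A k i j - A l i j‖ ≤ (A k).trace.re - (A l).trace.re := by
    intro k l hkl i j
    have := norm_apply_le_trace_re (sub_nonneg.mpr (hA hkl)) i j
    simpa [Matrix.trace_sub] using this
  have htp : ∀ k, 0 ≤ (A k).trace.re := fun k => by
    have := (Matrix.nonneg_iff_posSemidef.mp (h0 k)).trace_nonneg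
    exact (Complex.le_def.mp this).1
  have hanti : Antitone fun k => (A k).trace.re := fun k l hkl => by
    have := (Matrix.le_iff.mp (hA hkl)).trace_nonneg
    rw [Matrix.trace_sub] at this
    have := (Complex.le_def.mp this).1
    simp only [Complex.zero_re, Complex.sub_re] at this
    show (A l).trace.re ≤ (A k).trace.re
    linarith
  have hc : CauchySeq fun k => (A k).trace.re :=
    (tendsto_atTop_ciInf hanti ⟨0, by rintro _ ⟨k, rfl⟩; exact htp k⟩).cauchySeq
  have hex : ∀ i j, ∃ l, Tendsto (fun k => A k i j) atTop (𝓝 l) := fun i j => by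
    refine cauchySeq_tendsto_of_complete ?_
    rw [Metric.cauchySeq_iff'] at hc ⊢
    intro ε hε
    obtain ⟨k0, hk0⟩ := hc ε hε
    refine ⟨k0, fun k hk => ?_⟩
    rw [dist_comm, dist_eq_norm]
    refine (htr k0 k hk i j).trans_lt ?_
    have := hk0 k hk
    rw [dist_comm, Real.dist_eq] at this
    exact (le_abs_self _).trans_lt this
  choose L hL using hex
  exact ⟨Matrix.of L, tendsto_pi_nhds.mpr fun i => tendsto_pi_nhds.mpr fun j => hL i j⟩

lemma tendsto_inv_of_posDef {A : ℕ → Matrix n n ℂ} {L : Matrix n n ℂ} (hL : L.PosDef)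
    (h : Tendsto A atTop (𝓝 L)) : Tendsto (fun k => (A k)⁻¹) atTop (𝓝 L⁻¹) := by
  have hdet : L.det ≠ 0 := hL.det_pos.ne'
  have h1 : Tendsto (fun k => (A k).det) atTop (𝓝 L.det) :=
    (Continuous.matrix_det continuous_id).continuousAt.tendsto.comp h
  have h2 : Tendsto (fun k => (A k).adjugate) atTop (𝓝 L.adjugate) :=
    (Continuous.matrix_adjugate continuous_id).continuousAt.tendsto.comp h
  simp only [Matrix.inv_def, Ring.inverse_eq_inv']
  exact (h1.inv₀ hdet).smul h2

end Loewner


section Recursion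

open scoped MatrixOrder

variable {N K : ℕ} {ρ : ℝ}

/-! ### One step of the recursion -/

lemma innerMat_eq (F : Mat N K) (W : Mat K K) :
    innerMat ρ F W = 1 + ρ • (F * W * Fᴴ) := by
  rw [innerMat, Complex.coe_smul]

/-- The inverse of `recMap`, the positive definite matrix `I + ρ G^* (I + ρ F W F^*)⁻¹ G`. -/
noncomputable def recMapInv (ρ : ℝ) (F G : Mat N K) (W : Mat K K) : Mat K K :=
  1 + ρ • (Gᴴ * (innerMat ρ F W)⁻¹ * G)

lemma recMap_eq (F G : Mat N K) (W : Mat K K) :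
    recMap ρ F G W = (recMapInv ρ F G W)⁻¹ := by
  rw [recMap, recMapInv, Complex.coe_smul]

lemma innerMat_mono (hρ : 0 ≤ ρ) (F : Mat N K) {X Y : Mat K K} (h : X ≤ Y) :
    innerMat ρ F X ≤ innerMat ρ F Y := by
  rw [innerMat_eq, innerMat_eq]
  exact add_le_add_right (smul_le_smul_of_nonneg_left (mul_mul_conjTranspose_le F h) hρ) 1

lemma one_le_innerMat (hρ : 0 ≤ ρ) (F : Mat N K) {X : Mat K K} (h : 0 ≤ X) :
    1 ≤ innerMat ρ F X := by
  have := innerMat_mono hρ F h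
  simpa [innerMat_eq] using this

lemma innerMat_posDef (hρ : 0 ≤ ρ) (F : Mat N K) {X : Mat K K} (h : 0 ≤ X) :
    (innerMat ρ F X).PosDef :=
  posDef_of_le Matrix.PosDef.one (one_le_innerMat hρ F h)

lemma innerMat_le (hρ : 0 ≤ ρ) (F : Mat N K) {X : Mat K K} (h : X ≤ 1) :
    innerMat ρ F X ≤ (1 + ρ * ‖F‖ ^ 2) • (1 : Mat N N) := by
  rw [innerMat_eq, add_smul, one_smul, mul_smul]
  exact add_le_add_right (smul_le_smul_of_nonneg_left (mul_mul_conjTranspose_le_norm F h) hρ) 1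

lemma conjTranspose_mul_mul_le {A B : Mat N N} (G : Mat N K) (h : A ≤ B) :
    Gᴴ * A * G ≤ Gᴴ * B * G := by
  simpa using mul_mul_conjTranspose_le Gᴴ h

lemma recMapInv_le_of_inv_le (hρ : 0 ≤ ρ) (F G : Mat N K) {X Y : Mat K K}
    (h : (innerMat ρ F X)⁻¹ ≤ (innerMat ρ F Y)⁻¹) : recMapInv ρ F G X ≤ recMapInv ρ F G Y :=
  add_le_add_right (smul_le_smul_of_nonneg_left (conjTranspose_mul_mul_le G h) hρ) 1

lemma one_le_recMapInv (hρ : 0 ≤ ρ) (F G : Mat N K) {X : Mat K K} (h : 0 ≤ X) :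
    1 ≤ recMapInv ρ F G X := by
  refine le_add_of_nonneg_right (smul_nonneg hρ ?_)
  simpa using conjTranspose_mul_mul_le G
    (Matrix.nonneg_iff_posSemidef.mpr (innerMat_posDef hρ F h).inv.posSemidef)

lemma recMapInv_posDef (hρ : 0 ≤ ρ) (F G : Mat N K) {X : Mat K K} (h : 0 ≤ X) :
    (recMapInv ρ F G X).PosDef :=
  posDef_of_le Matrix.PosDef.one (one_le_recMapInv hρ F G h)

lemma recMapInv_le (hρ : 0 ≤ ρ) (F G : Mat N K) {X : Mat K K} (h : 0 ≤ X) :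
    recMapInv ρ F G X ≤ (1 + ρ * ‖G‖ ^ 2) • (1 : Mat K K) := by
  rw [recMapInv, add_smul, one_smul, mul_smul]
  refine add_le_add_right (smul_le_smul_of_nonneg_left ?_ hρ) 1
  have h1 : (innerMat ρ F X)⁻¹ ≤ 1 := by
    simpa using inv_le_inv_of_le Matrix.PosDef.one (one_le_innerMat hρ F h)
  simpa [Matrix.l2_opNorm_conjTranspose] using mul_mul_conjTranspose_le_norm Gᴴ h1

lemma recMap_posDef (hρ : 0 ≤ ρ) (F G : Mat N K) {X : Mat K K} (h : 0 ≤ X) :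
    (recMap ρ F G X).PosDef := by
  rw [recMap_eq]; exact (recMapInv_posDef hρ F G h).inv

lemma recMap_nonneg (hρ : 0 ≤ ρ) (F G : Mat N K) {X : Mat K K} (h : 0 ≤ X) :
    0 ≤ recMap ρ F G X :=
  Matrix.nonneg_iff_posSemidef.mpr (recMap_posDef hρ F G h).posSemidef

lemma recMap_le_one (hρ : 0 ≤ ρ) (F G : Mat N K) {X : Mat K K} (h : 0 ≤ X) :
    recMap ρ F G X ≤ 1 := by
  rw [recMap_eq]
  simpa using inv_le_inv_of_le Matrix.PosDef.one (one_le_recMapInv hρ F G h)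

lemma recMap_mono (hρ : 0 ≤ ρ) (F G : Mat N K) {X Y : Mat K K} (hX : 0 ≤ X) (h : X ≤ Y) :
    recMap ρ F G X ≤ recMap ρ F G Y := by
  rw [recMap_eq, recMap_eq]
  exact inv_le_inv_of_le (recMapInv_posDef hρ F G (hX.trans h))
    (recMapInv_le_of_inv_le hρ F G
      (inv_le_inv_of_le (innerMat_posDef hρ F hX) (innerMat_mono hρ F h)))

lemma one_le_smul_recMap (hρ : 0 ≤ ρ) (F G : Mat N K) {X : Mat K K} (h : 0 ≤ X) :
    1 ≤ (1 + ρ * ‖G‖ ^ 2) • recMap ρ F G X := by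
  rw [recMap_eq]
  have := inv_le_smul_inv_of_le_smul (B := (1 : Mat K K)) (recMapInv_posDef hρ F G h)
    (c := 1 + ρ * ‖G‖ ^ 2) (by positivity) (recMapInv_le hρ F G h)
  simpa using this

/-- The recursion contracts relative bounds between two matrices: the excess `t` is multiplied by
at most `c / (1 + c)`, where `c` bounds `ρ ‖F‖²`. -/
lemma recMap_le_smul_recMap (hρ : 0 ≤ ρ) (F G : Mat N K) {X Y : Mat K K} (hX : 0 ≤ X)
    (hY : 0 ≤ Y) (hY1 : Y ≤ 1) {t c : ℝ} (ht : 0 ≤ t) (hc : ρ * ‖F‖ ^ 2 ≤ c)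
    (h : X ≤ (1 + t) • Y) :
    recMap ρ F G X ≤ (1 + c / (1 + c) * t) • recMap ρ F G Y := by
  have hc0 : 0 ≤ c := le_trans (by positivity) hc
  set s := c / (1 + c) * t with hs
  have hs0 : 0 ≤ s := by positivity
  set Q : Mat N N := ρ • (F * Y * Fᴴ) with hQ
  have hQc : Q ≤ c • (1 : Mat N N) := by
    have h1 := smul_le_smul_of_nonneg_left (mul_mul_conjTranspose_le_norm F hY1) hρ
    rw [smul_smul] at h1
    exact h1.trans (smul_le_smul_of_nonneg_right hc zero_le_one)
  have hinner : innerMat ρ F X ≤ (1 + s) • innerMat ρ F Y := by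
    have h1 : innerMat ρ F X ≤ 1 + (1 + t) • Q := by
      have := innerMat_mono hρ F h
      rwa [innerMat_eq F ((1 + t) • Y), Matrix.mul_smul, Matrix.smul_mul, smul_comm, ← hQ] at this
    refine h1.trans ?_
    rw [innerMat_eq F Y, ← hQ, ← sub_nonneg]
    -- the difference is `t / (1 + c) • (c • 1 - Q)`
    have h2 : (1 + s) • (1 + Q) - (1 + (1 + t) • Q) = (t / (1 + c)) • (c • (1 : Mat N N) - Q) := by
      have hs1 : s = t / (1 + c) * c := by rw [hs]; ring
      have hs2 : t = t / (1 + c) + s := by rw [hs1]; field_simp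
      rw [smul_sub, smul_smul (t / (1 + c)) c (1 : Mat N N), ← hs1]
      have : (1 + t) = 1 + s + t / (1 + c) := by linarith
      rw [this]
      module
    rw [h2]
    exact smul_nonneg (by positivity) (sub_nonneg.mpr hQc)
  have hs1 : 0 < 1 + s := by linarith
  have hinv := inv_le_smul_inv_of_le_smul (innerMat_posDef hρ F hX) hs1 hinner
  have h3 : recMapInv ρ F G Y ≤ (1 + s) • recMapInv ρ F G X := by
    have h4 := smul_le_smul_of_nonneg_left (conjTranspose_mul_mul_le G hinv) hρ
    rw [Matrix.mul_smul, Matrix.smul_mul, smul_comm] at h4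
    have h5 : (1 : Mat K K) ≤ (1 + s) • 1 := by
      rw [add_smul, one_smul]
      exact le_add_of_nonneg_right (smul_nonneg hs0 zero_le_one)
    rw [recMapInv, recMapInv, smul_add]
    exact add_le_add h5 h4
  rw [recMap_eq, recMap_eq]
  exact inv_le_smul_inv_of_le_smul (recMapInv_posDef hρ F G hY) hs1 h3

/-- The increment `log det (I + ρ F X F^*) - log det X'` of the mutual information in the step
from `X` to `X' = recMap ρ F G X`. -/
noncomputable def stepLogDet (ρ : ℝ) (F G : Mat N K) (X : Mat K K) : ℝ :=
  logDet (innerMat ρ F X) - logDet (recMap ρ F G X)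

/-- The Schur complement `I + ρ F X F^* + ρ G G^*` of one step. -/
noncomputable def schurMat (ρ : ℝ) (F G : Mat N K) (X : Mat K K) : Mat N N :=
  innerMat ρ F X + ρ • (G * Gᴴ)

lemma schurMat_posDef (hρ : 0 ≤ ρ) (F G : Mat N K) {X : Mat K K} (h : 0 ≤ X) :
    (schurMat ρ F G X).PosDef :=
  posDef_of_le (innerMat_posDef hρ F h) (le_add_of_nonneg_right (smul_nonneg hρ
    (Matrix.nonneg_iff_posSemidef.mpr (Matrix.posSemidef_self_mul_conjTranspose G))))

lemma isUnit_det {n : ℕ} {A : Mat n n} (hA : A.PosDef) : IsUnit A.det :=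
  (Matrix.isUnit_iff_isUnit_det _).mp hA.isUnit

lemma logDet_schurMat (hρ : 0 ≤ ρ) (F G : Mat N K) {X : Mat K K} (h : 0 ≤ X) :
    logDet (schurMat ρ F G X) = stepLogDet ρ F G X := by
  rw [stepLogDet, recMap_eq, logDet_inv (recMapInv_posDef hρ F G h), sub_neg_eq_add]
  refine logDet_of_det_eq_mul (innerMat_posDef hρ F h) (recMapInv_posDef hρ F G h) ?_
  rw [schurMat, ← Matrix.smul_mul,
    Matrix.det_add_mul _ _ (isUnit_det (innerMat_posDef hρ F h)), recMapInv, Matrix.mul_smul]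

/-- The Woodbury identity for `recMap`. -/
lemma recMap_eq_one_sub (hρ : 0 ≤ ρ) (F G : Mat N K) {X : Mat K K} (h : 0 ≤ X) :
    recMap ρ F G X = 1 - ρ • (Gᴴ * (schurMat ρ F G X)⁻¹ * G) := by
  rw [recMap_eq]
  apply Matrix.inv_eq_right_inv
  set A := innerMat ρ F X with hA
  set S := schurMat ρ F G X with hS
  have hAu : IsUnit A.det := isUnit_det (innerMat_posDef hρ F h)
  have hSu : IsUnit S.det := isUnit_det (schurMat_posDef hρ F G h)
  have hSA : ρ • (G * Gᴴ) = S - A := by rw [hS, schurMat]; abel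
  have h1 : A⁻¹ * (S - A) * S⁻¹ = A⁻¹ - S⁻¹ := by
    rw [Matrix.mul_sub, Matrix.sub_mul, Matrix.nonsing_inv_mul _ hAu, Matrix.one_mul,
      Matrix.mul_assoc, Matrix.mul_nonsing_inv _ hSu, Matrix.mul_one]
  have h2 : (Gᴴ * A⁻¹ * G) * (ρ • (Gᴴ * S⁻¹ * G)) = Gᴴ * (A⁻¹ - S⁻¹) * G := by
    rw [← h1, ← hSA]
    simp only [Matrix.mul_smul, Matrix.smul_mul, Matrix.mul_assoc]
  rw [recMapInv, Matrix.add_mul, Matrix.one_mul, Matrix.mul_sub, Matrix.mul_one, Matrix.smul_mul, h2,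
    Matrix.mul_sub, Matrix.sub_mul, smul_sub]
  abel

lemma stepLogDet_mono (hρ : 0 ≤ ρ) (F G : Mat N K) {X Y : Mat K K} (hX : 0 ≤ X) (h : X ≤ Y) :
    stepLogDet ρ F G X ≤ stepLogDet ρ F G Y := by
  rw [← logDet_schurMat hρ F G hX, ← logDet_schurMat hρ F G (hX.trans h)]
  exact logDet_le_logDet (schurMat_posDef hρ F G hX)
    (add_le_add_left (innerMat_mono hρ F h) _)

/-- `det (I + ρ F X F^*) = det X · det (X⁻¹ + ρ F^* F)`. -/
lemma logDet_innerMat_sub (hρ : 0 ≤ ρ) (F : Mat N K) {X : Mat K K} (hX : X.PosDef) :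
    logDet (innerMat ρ F X) - logDet X = logDet (X⁻¹ + ρ • (Fᴴ * F)) := by
  have hP : (X⁻¹ + ρ • (Fᴴ * F)).PosDef :=
    posDef_of_le hX.inv (le_add_of_nonneg_right (smul_nonneg hρ
      (Matrix.nonneg_iff_posSemidef.mpr (Matrix.posSemidef_conjTranspose_mul_self F))))
  have h := logDet_of_det_eq_mul (A := innerMat ρ F X) hX hP (by
    rw [← Matrix.det_mul, Matrix.mul_add, Matrix.mul_nonsing_inv _ (isUnit_det hX), innerMat_eq,
      Matrix.mul_assoc, ← Matrix.mul_smul, Matrix.det_one_add_mul_comm, Matrix.smul_mul,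
      Matrix.mul_smul, Matrix.mul_assoc])
  linarith

/-- The increments from two ordered starting points differ by no more than the decrease of
`log det X - log det Y`. -/
lemma stepLogDet_sub_le (hρ : 0 ≤ ρ) (F G : Mat N K) {X Y : Mat K K} (hY : Y.PosDef) (h : Y ≤ X) :
    stepLogDet ρ F G X - stepLogDet ρ F G Y ≤
      (logDet X - logDet Y) - (logDet (recMap ρ F G X) - logDet (recMap ρ F G Y)) := by
  have hX := posDef_of_le hY h
  have h1 : X⁻¹ + ρ • (Fᴴ * F) ≤ Y⁻¹ + ρ • (Fᴴ * F) := add_le_add_left (inv_le_inv_of_le hY h) _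
  have h2 := logDet_le_logDet (posDef_of_le hX.inv (le_add_of_nonneg_right (smul_nonneg hρ
      (Matrix.nonneg_iff_posSemidef.mpr (Matrix.posSemidef_conjTranspose_mul_self F))))) h1
  rw [← logDet_innerMat_sub hρ F hX, ← logDet_innerMat_sub hρ F hY] at h2
  simp only [stepLogDet]
  linarith

lemma logDet_innerMat_nonneg (hρ : 0 ≤ ρ) (F : Mat N K) {X : Mat K K} (h : 0 ≤ X) :
    0 ≤ logDet (innerMat ρ F X) := logDet_nonneg (one_le_innerMat hρ F h)

lemma logDet_innerMat_le (hρ : 0 ≤ ρ) (F : Mat N K) {X : Mat K K} (h : 0 ≤ X) (h1 : X ≤ 1) :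
    logDet (innerMat ρ F X) ≤ N * (ρ * ‖F‖ ^ 2) := by
  simpa using logDet_le_mul (innerMat_posDef hρ F h) (by positivity) (innerMat_le hρ F h1)

lemma logDet_recMap_nonpos (hρ : 0 ≤ ρ) (F G : Mat N K) {X : Mat K K} (h : 0 ≤ X) :
    logDet (recMap ρ F G X) ≤ 0 := by
  rw [recMap_eq, logDet_inv (recMapInv_posDef hρ F G h)]
  linarith [logDet_nonneg (one_le_recMapInv hρ F G h)]

lemma neg_logDet_recMap_le (hρ : 0 ≤ ρ) (F G : Mat N K) {X : Mat K K} (h : 0 ≤ X) :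
    -logDet (recMap ρ F G X) ≤ K * (ρ * ‖G‖ ^ 2) := by
  rw [recMap_eq, logDet_inv (recMapInv_posDef hρ F G h), neg_neg]
  simpa using logDet_le_mul (recMapInv_posDef hρ F G h) (by positivity) (recMapInv_le hρ F G h)

lemma tendsto_recMap (hρ : 0 ≤ ρ) (F G : Mat N K) {A : ℕ → Mat K K} {L : Mat K K} (hL : 0 ≤ L)
    (h : Tendsto A atTop (𝓝 L)) :
    Tendsto (fun k => recMap ρ F G (A k)) atTop (𝓝 (recMap ρ F G L)) := by
  have h1 : Tendsto (fun k => innerMat ρ F (A k)) atTop (𝓝 (innerMat ρ F L)) := by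
    have hc : Continuous fun X : Mat K K => innerMat ρ F X := by
      unfold innerMat; fun_prop
    exact hc.continuousAt.tendsto.comp h
  have h2 := tendsto_inv_of_posDef (innerMat_posDef hρ F hL) h1
  have hc : Continuous fun X : Mat N N => 1 + ρ • (Gᴴ * X * G) := by fun_prop
  have h3 : Tendsto (fun k => recMapInv ρ F G (A k)) atTop (𝓝 (recMapInv ρ F G L)) :=
    hc.continuousAt.tendsto.comp h2
  simp only [recMap_eq]
  exact tendsto_inv_of_posDef (recMapInv_posDef hρ F G hL) h3

end Recursion


section Trajectories

open scoped MatrixOrder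

variable {N K : ℕ} {ρ : ℝ}

/-! ### Trajectories of the recursion -/

lemma recursionFrom_nonneg (hρ : 0 ≤ ρ) (f g : ℤ → Mat N K) {X : Mat K K} (hX : 0 ≤ X) (j : ℕ) :
    0 ≤ recursionFrom ρ f g X j := by
  induction j with
  | zero => exact hX
  | succ j ih => exact recMap_nonneg hρ _ _ ih

lemma recursionFrom_posDef (hρ : 0 ≤ ρ) (f g : ℤ → Mat N K) {X : Mat K K} (hX : X.PosDef)
    (j : ℕ) : (recursionFrom ρ f g X j).PosDef := by
  cases j with
  | zero => exact hX
  | succ j =>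
    exact recMap_posDef hρ _ _
      (recursionFrom_nonneg hρ f g (Matrix.nonneg_iff_posSemidef.mpr hX.posSemidef) j)

lemma recursionFrom_mono (hρ : 0 ≤ ρ) (f g : ℤ → Mat N K) {X Y : Mat K K} (hX : 0 ≤ X)
    (h : X ≤ Y) (j : ℕ) : recursionFrom ρ f g X j ≤ recursionFrom ρ f g Y j := by
  induction j with
  | zero => exact h
  | succ j ih => exact recMap_mono hρ _ _ (recursionFrom_nonneg hρ f g hX j) ih

lemma recursionFrom_succ' (f g : ℤ → Mat N K) (X : Mat K K) (j : ℕ) :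
    recursionFrom ρ f g X (j + 1) =
      recursionFrom ρ (fun k => f (k + 1)) (fun k => g (k + 1)) (recMap ρ (f 0) (g 0) X) j := by
  induction j with
  | zero => rfl
  | succ j ih =>
    rw [recursionFrom, ih, recursionFrom]
    push_cast
    rfl

/-- The sum of the first `k` increments of `log det` along the recursion started from `X`. -/
noncomputable def sumStep (ρ : ℝ) (f g : ℤ → Mat N K) (X : Mat K K) (k : ℕ) : ℝ :=
  ∑ j ∈ Finset.range k, stepLogDet ρ (f j) (g j) (recursionFrom ρ f g X j)

lemma sumStep_succ' (f g : ℤ → Mat N K) (X : Mat K K) (k : ℕ) :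
    sumStep ρ f g X (k + 1) = stepLogDet ρ (f 0) (g 0) X +
      sumStep ρ (fun k => f (k + 1)) (fun k => g (k + 1)) (recMap ρ (f 0) (g 0) X) k := by
  rw [sumStep, Finset.sum_range_succ', add_comm, sumStep]
  simp only [recursionFrom_succ']
  push_cast
  rfl

lemma sumStep_mono (hρ : 0 ≤ ρ) (f g : ℤ → Mat N K) {X Y : Mat K K} (hX : 0 ≤ X)
    (h : X ≤ Y) (k : ℕ) : sumStep ρ f g X k ≤ sumStep ρ f g Y k :=
  Finset.sum_le_sum fun j _ => stepLogDet_mono hρ _ _ (recursionFrom_nonneg hρ f g hX j)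
    (recursionFrom_mono hρ f g hX h j)

/-- The single-step bounds of `stepLogDet_sub_le` telescope, so that the effect of the starting
point on the sum of the increments is bounded uniformly in the number of steps. -/
lemma sumStep_sub_le (hρ : 0 ≤ ρ) (f g : ℤ → Mat N K) {X Y : Mat K K} (hY : Y.PosDef)
    (h : Y ≤ X) (k : ℕ) : sumStep ρ f g X k - sumStep ρ f g Y k ≤ logDet X - logDet Y := by
  have hY0 : 0 ≤ Y := Matrix.nonneg_iff_posSemidef.mpr hY.posSemidef
  have key : sumStep ρ f g X k - sumStep ρ f g Y k ≤ (logDet X - logDet Y) -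
      (logDet (recursionFrom ρ f g X k) - logDet (recursionFrom ρ f g Y k)) := by
    induction k with
    | zero => simp [sumStep, recursionFrom]
    | succ k ih =>
      have hs := stepLogDet_sub_le hρ (f k) (g k) (recursionFrom_posDef hρ f g hY k)
        (recursionFrom_mono hρ f g hY0 h k)
      rw [sumStep, sumStep, Finset.sum_range_succ, Finset.sum_range_succ, recursionFrom,
        recursionFrom]
      rw [sumStep, sumStep] at ih
      linarith
  have := logDet_le_logDet (recursionFrom_posDef hρ f g hY k) (recursionFrom_mono hρ f g hY0 h k)
  linarith

/-- A solution of the recursion indexed by all integers is its own trajectory. -/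
lemma recursionFrom_of_solution {f g : ℤ → Mat N K} {W : ℤ → Mat K K}
    (hW : ∀ n, W n = recMap ρ (f n) (g n) (W (n - 1))) (m : ℤ) (j : ℕ) :
    recursionFrom ρ (fun k => f (m + k)) (fun k => g (m + k)) (W (m - 1)) j = W (m - 1 + j) := by
  induction j with
  | zero => simp [recursionFrom]
  | succ j ih =>
    rw [recursionFrom, ih, hW (m - 1 + (j + 1 : ℕ))]
    have h1 : m - 1 + ((j + 1 : ℕ) : ℤ) = m + j := by push_cast; ring
    have h2 : m + (j : ℤ) - 1 = m - 1 + j := by ring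
    rw [h1, h2]

/-! ### The two-sided solution -/

/-- The value at time `n` of the recursion started from `I` at time `n - k`. -/
noncomputable def pullback (ρ : ℝ) (f g : ℤ → Mat N K) : ℤ → ℕ → Mat K K
  | _, 0 => 1
  | n, k + 1 => recMap ρ (f n) (g n) (pullback ρ f g (n - 1) k)

lemma pullback_nonneg (hρ : 0 ≤ ρ) (f g : ℤ → Mat N K) (n : ℤ) (k : ℕ) :
    0 ≤ pullback ρ f g n k := by
  induction k generalizing n with
  | zero => exact zero_le_one
  | succ k ih => exact recMap_nonneg hρ _ _ (ih _)

lemma pullback_antitone (hρ : 0 ≤ ρ) (f g : ℤ → Mat N K) (n : ℤ) :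
    Antitone (pullback ρ f g n) := by
  refine antitone_nat_of_succ_le fun k => ?_
  induction k generalizing n with
  | zero => exact recMap_le_one hρ _ _ (pullback_nonneg hρ f g _ _)
  | succ k ih => exact recMap_mono hρ _ _ (pullback_nonneg hρ f g _ _) (ih _)

/-- The two-sided solution of the recursion: the limit of the recursion started from `I` in the
remote past. -/
noncomputable def pastLimit (ρ : ℝ) (f g : ℤ → Mat N K) (n : ℤ) : Mat K K :=
  limUnder atTop (pullback ρ f g n)

lemma tendsto_pullback (hρ : 0 ≤ ρ) (f g : ℤ → Mat N K) (n : ℤ) :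
    Tendsto (pullback ρ f g n) atTop (𝓝 (pastLimit ρ f g n)) :=
  tendsto_nhds_limUnder
    (exists_tendsto_of_antitone (pullback_antitone hρ f g n) (pullback_nonneg hρ f g n))

lemma pastLimit_nonneg (hρ : 0 ≤ ρ) (f g : ℤ → Mat N K) (n : ℤ) : 0 ≤ pastLimit ρ f g n :=
  ge_of_tendsto' (tendsto_pullback hρ f g n) (pullback_nonneg hρ f g n)

lemma pastLimit_eq_recMap (hρ : 0 ≤ ρ) (f g : ℤ → Mat N K) (n : ℤ) :
    pastLimit ρ f g n = recMap ρ (f n) (g n) (pastLimit ρ f g (n - 1)) :=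
  tendsto_nhds_unique ((tendsto_pullback hρ f g n).comp (tendsto_add_atTop_nat 1))
    (tendsto_recMap hρ (f n) (g n) (pastLimit_nonneg hρ f g _) (tendsto_pullback hρ f g (n - 1)))

lemma pastLimit_posDef (hρ : 0 ≤ ρ) (f g : ℤ → Mat N K) (n : ℤ) :
    (pastLimit ρ f g n).PosDef := by
  rw [pastLimit_eq_recMap hρ]
  exact recMap_posDef hρ _ _ (pastLimit_nonneg hρ f g _)

lemma pastLimit_le_one (hρ : 0 ≤ ρ) (f g : ℤ → Mat N K) (n : ℤ) : pastLimit ρ f g n ≤ 1 := by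
  rw [pastLimit_eq_recMap hρ]
  exact recMap_le_one hρ _ _ (pastLimit_nonneg hρ f g _)

lemma pullback_shift (f g : ℤ → Mat N K) (n : ℤ) (k : ℕ) :
    pullback ρ (fun n => f (n + 1)) (fun n => g (n + 1)) n k = pullback ρ f g (n + 1) k := by
  induction k generalizing n with
  | zero => rfl
  | succ k ih =>
    rw [pullback, pullback, ih]
    simp

lemma pastLimit_shift (f g : ℤ → Mat N K) (n : ℤ) :
    pastLimit ρ (fun n => f (n + 1)) (fun n => g (n + 1)) n = pastLimit ρ f g (n + 1) := by
  have h : pullback ρ (fun n => f (n + 1)) (fun n => g (n + 1)) n = pullback ρ f g (n + 1) :=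
    funext fun k => pullback_shift f g n k
  rw [pastLimit, pastLimit, h]

/-- Relative bounds between two solutions propagate forward in time. -/
lemma solution_le_smul_of_le (hρ : 0 ≤ ρ) {f g : ℤ → Mat N K} {W W' : ℤ → Mat K K}
    (hW0 : ∀ n, 0 ≤ W n) (hW0' : ∀ n, 0 ≤ W' n)
    (hW : ∀ n, W n = recMap ρ (f n) (g n) (W (n - 1)))
    (hW' : ∀ n, W' n = recMap ρ (f n) (g n) (W' (n - 1))) {t : ℝ} (ht : 0 ≤ t) {k n : ℤ}
    (hkn : k ≤ n) (h : W k ≤ (1 + t) • W' k) : W n ≤ (1 + t) • W' n := by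
  induction n, hkn using Int.leInduction with
  | base => exact h
  | succ n _ ih =>
    have h1 : ∀ n, W' n ≤ 1 := fun n => by
      rw [hW']; exact recMap_le_one hρ _ _ (hW0' _)
    have h2 := recMap_le_smul_recMap hρ (f (n + 1)) (g (n + 1)) (hW0 n) (hW0' n) (h1 n) ht le_rfl ih
    rw [hW (n + 1), hW' (n + 1), add_sub_cancel_right]
    refine h2.trans (smul_le_smul_of_nonneg_right ?_ (recMap_nonneg hρ _ _ (hW0' n)))
    have h3 : ρ * ‖f (n + 1)‖ ^ 2 / (1 + ρ * ‖f (n + 1)‖ ^ 2) ≤ 1 := by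
      apply div_le_one_of_le₀ <;> nlinarith [mul_nonneg hρ (sq_nonneg ‖f (n + 1)‖)]
    nlinarith

/-- If the coefficients are bounded along times tending to `-∞`, then two solutions are ordered:
at each of these times the excess in a relative bound between the two contracts by a fixed
factor. -/
lemma solution_le_solution (hρ : 0 ≤ ρ) {f g : ℤ → Mat N K} {W W' : ℤ → Mat K K}
    (hW0 : ∀ n, 0 ≤ W n) (hW0' : ∀ n, 0 ≤ W' n)
    (hW : ∀ n, W n = recMap ρ (f n) (g n) (W (n - 1)))
    (hW' : ∀ n, W' n = recMap ρ (f n) (g n) (W' (n - 1))) {M : ℝ}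
    (hM : ∀ n : ℤ, ∃ k ≤ n, ρ * ‖f k‖ ^ 2 ≤ M ∧ ρ * ‖g k‖ ^ 2 ≤ M) (n : ℤ) : W n ≤ W' n := by
  have hM0 : 0 ≤ M := by
    obtain ⟨k, -, hk, -⟩ := hM 0
    exact le_trans (by positivity) hk
  have h1 : ∀ n, W n ≤ 1 := fun n => by
    rw [hW]; exact recMap_le_one hρ _ _ (hW0 _)
  have h1' : ∀ n, W' n ≤ 1 := fun n => by
    rw [hW']; exact recMap_le_one hρ _ _ (hW0' _)
  set q := M / (1 + M) with hq
  have hq0 : 0 ≤ q := by positivity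
  have hq1 : q < 1 := by rw [hq, div_lt_one] <;> linarith
  have key : ∀ j : ℕ, ∀ n, W n ≤ (1 + q ^ j * M) • W' n := by
    intro j
    induction j with
    | zero =>
      intro n
      obtain ⟨k, hk, -, hg⟩ := hM n
      rw [pow_zero, one_mul]
      refine solution_le_smul_of_le hρ hW0 hW0' hW hW' hM0 hk ?_
      have h2 := one_le_smul_recMap hρ (f k) (g k) (hW0' (k - 1))
      rw [← hW'] at h2
      exact ((h1 k).trans h2).trans (smul_le_smul_of_nonneg_right (by linarith) (hW0' k))
    | succ j ih =>
      intro n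
      obtain ⟨k, hk, hf, -⟩ := hM n
      refine solution_le_smul_of_le hρ hW0 hW0' hW hW' (by positivity) hk ?_
      have h2 := recMap_le_smul_recMap hρ (f k) (g k) (hW0 (k - 1)) (hW0' (k - 1)) (h1' (k - 1))
        (t := q ^ j * M) (by positivity) hf (ih (k - 1))
      rw [← hW, ← hW', ← hq] at h2
      rwa [pow_succ', mul_assoc]
  have hlim : Tendsto (fun j : ℕ => (1 + q ^ j * M) • W' n) atTop (𝓝 ((1 + 0 * M) • W' n)) :=
    (((tendsto_pow_atTop_nhds_zero_of_lt_one hq0 hq1).mul_const M).const_add 1).smul_const _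
  rw [zero_mul, add_zero, one_smul] at hlim
  exact ge_of_tendsto' hlim fun j => key j n

end Trajectories


section BlockDeterminant

open scoped MatrixOrder

variable {N K : ℕ} {ρ : ℝ}

/-! ### The determinant of the block matrix -/

/-- The block tridiagonal matrix with diagonal blocks `I + ρ F_i F_i^* + ρ G_i G_i^*` and
off-diagonal blocks `ρ G_i F_{i+1}^*` and `ρ F_{i+1} G_i^*`, indexed by all integers, except that
the diagonal block at time `m` is `I + ρ F_m X F_m^* + ρ G_m G_m^*`. -/
noncomputable def tridiag (ρ : ℝ) (f g : ℤ → Mat N K) (m : ℤ) (X : Mat K K) :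
    Matrix (ℤ × Fin N) (ℤ × Fin N) ℂ :=
  Matrix.of fun r c =>
    if r.1 = c.1 then schurMat ρ (f r.1) (g r.1) (if r.1 = m then X else 1) r.2 c.2
    else if c.1 = r.1 + 1 then (ρ • (g r.1 * (f c.1)ᴴ)) r.2 c.2
    else if r.1 = c.1 + 1 then (ρ • (f r.1 * (g c.1)ᴴ)) r.2 c.2
    else 0

/-- The restriction of `tridiag ρ f g m X` to the times `m, …, n`. -/
noncomputable def windowMat (ρ : ℝ) (f g : ℤ → Mat N K) (m n : ℤ) (X : Mat K K) :
    Matrix (Finset.Icc m n × Fin N) (Finset.Icc m n × Fin N) ℂ :=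
  (tridiag ρ f g m X).submatrix (fun r => ((r.1 : ℤ), r.2)) (fun r => ((r.1 : ℤ), r.2))

/-- Separates the block at time `m` from the blocks at the later times of the window. -/
noncomputable def windowEquiv (N : ℕ) {m n : ℤ} (h : m ≤ n) :
    Fin N ⊕ (Finset.Icc (m + 1) n × Fin N) ≃ Finset.Icc m n × Fin N :=
  Equiv.ofBijective
    (Sum.elim (fun a => (⟨m, Finset.mem_Icc.mpr ⟨le_rfl, h⟩⟩, a))
      (fun p => (⟨p.1, by have := Finset.mem_Icc.mp p.1.2; rw [Finset.mem_Icc]; omega⟩, p.2))) (by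
    constructor
    · rintro (a | ⟨⟨i, hi⟩, a⟩) (b | ⟨⟨j, hj⟩, b⟩) hab <;>
        simp only [Sum.elim_inl, Sum.elim_inr, Prod.mk.injEq, Subtype.mk.injEq] at hab <;>
        grind
    · rintro ⟨⟨i, hi⟩, a⟩
      rw [Finset.mem_Icc] at hi
      rcases hi.1.eq_or_lt with rfl | hlt
      · exact ⟨Sum.inl a, rfl⟩
      · exact ⟨Sum.inr (⟨i, Finset.mem_Icc.mpr ⟨hlt, hi.2⟩⟩, a), rfl⟩)

lemma windowEquiv_inl {m n : ℤ} (h : m ≤ n) (a : Fin N) :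
    windowEquiv N h (Sum.inl a) = (⟨m, Finset.mem_Icc.mpr ⟨le_rfl, h⟩⟩, a) := rfl

lemma coe_windowEquiv_inr {m n : ℤ} (h : m ≤ n) (p : Finset.Icc (m + 1) n × Fin N) :
    ((windowEquiv N h (Sum.inr p)).1 : ℤ) = p.1 := rfl

lemma windowEquiv_inr_snd {m n : ℤ} (h : m ≤ n) (p : Finset.Icc (m + 1) n × Fin N) :
    (windowEquiv N h (Sum.inr p)).2 = p.2 := rfl

lemma schurMat_sub (hρ : 0 ≤ ρ) (f g f' g' : Mat N K) {X : Mat K K} (hX : 0 ≤ X) :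
    schurMat ρ f' g' 1 - (ρ • (f' * gᴴ)) * (schurMat ρ f g X)⁻¹ * (ρ • (g * f'ᴴ)) =
      schurMat ρ f' g' (recMap ρ f g X) := by
  rw [recMap_eq_one_sub hρ f g hX]
  generalize (schurMat ρ f g X)⁻¹ = S
  rw [schurMat, schurMat, innerMat_eq, innerMat_eq]
  simp only [Matrix.mul_sub, Matrix.sub_mul, Matrix.mul_smul, Matrix.smul_mul, Matrix.mul_assoc,
    Matrix.mul_one, smul_sub, smul_smul]
  abel

/-- Eliminating the block at time `m` by a Schur complement turns the matrix for `X` into the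
matrix of the shorter window for `recMap ρ (f m) (g m) X`. -/
lemma det_windowMat_eq_mul (hρ : 0 ≤ ρ) (f g : ℤ → Mat N K) {m n : ℤ} (h : m ≤ n)
    {X : Mat K K} (hX : 0 ≤ X) :
    (windowMat ρ f g m n X).det = (schurMat ρ (f m) (g m) X).det *
      (windowMat ρ f g (m + 1) n (recMap ρ (f m) (g m) X)).det := by
  rw [← Matrix.det_submatrix_equiv_self (windowEquiv N h)]
  set M := (windowMat ρ f g m n X).submatrix (windowEquiv N h) (windowEquiv N h) with hM
  have h11 : M.toBlocks₁₁ = schurMat ρ (f m) (g m) X := by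
    ext a b
    simp [hM, Matrix.toBlocks₁₁, windowMat, tridiag, windowEquiv_inl]
  have hS : IsUnit (schurMat ρ (f m) (g m) X).det := isUnit_det (schurMat_posDef hρ _ _ hX)
  rw [← Matrix.fromBlocks_toBlocks M, h11]
  let _ := Matrix.invertibleOfIsUnitDet _ hS
  rw [Matrix.det_fromBlocks₁₁, Matrix.invOf_eq_nonsing_inv]
  congr 2
  ext ⟨⟨i, hi⟩, a⟩ ⟨⟨j, hj⟩, b⟩
  have hi' := Finset.mem_Icc.mp hi
  have hj' := Finset.mem_Icc.mp hj
  have him : i ≠ m := by omega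
  have hjm : j ≠ m := by omega
  have hmj : m ≠ j := by omega
  have e21 : ∀ c, M.toBlocks₂₁ (⟨i, hi⟩, a) c =
      if i = m + 1 then (ρ • (f (m + 1) * (g m)ᴴ)) a c else 0 := fun c => by
    have : m ≠ i + 1 := by omega
    simp only [hM, Matrix.toBlocks₂₁, windowMat, tridiag, Matrix.of_apply,
      Matrix.submatrix_apply, windowEquiv_inl, coe_windowEquiv_inr, windowEquiv_inr_snd, him, this,
      if_false]
    split_ifs with h1
    · rw [h1]
    · rfl
  have e12 : ∀ c, M.toBlocks₁₂ c (⟨j, hj⟩, b) =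
      if j = m + 1 then (ρ • (g m * (f (m + 1))ᴴ)) c b else 0 := fun c => by
    have : m ≠ j + 1 := by omega
    simp only [hM, Matrix.toBlocks₁₂, windowMat, tridiag, Matrix.of_apply,
      Matrix.submatrix_apply, windowEquiv_inl, coe_windowEquiv_inr, windowEquiv_inr_snd, hmj, this,
      if_false]
    split_ifs with h1
    · rw [h1]
    · rfl
  have e22 : M.toBlocks₂₂ (⟨i, hi⟩, a) (⟨j, hj⟩, b) = tridiag ρ f g m X (i, a) (j, b) := rfl
  have key := schurMat_sub hρ (f m) (g m) (f (m + 1)) (g (m + 1)) hX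
  generalize ρ • (f (m + 1) * (g m)ᴴ) = C at e21 key
  generalize ρ • (g m * (f (m + 1))ᴴ) = B at e12 key
  rw [Matrix.sub_apply, e22]
  simp only [Matrix.mul_apply, e21, e12, windowMat, Matrix.submatrix_apply]
  by_cases h1 : i = m + 1
  · by_cases h2 : j = m + 1
    · subst h1
      subst h2
      have := congrFun (congrFun key a) b
      simpa [tridiag, Matrix.mul_apply] using this
    · have h3 : ¬ m + 1 = j := fun h => h2 h.symm
      subst h1
      simp [tridiag, h2, h3]
  · simp [tridiag, h1, him]

lemma det_windowMat (hρ : 0 ≤ ρ) (f g : ℤ → Mat N K) (k : ℕ) (m : ℤ) {X : Mat K K} (hX : 0 ≤ X) :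
    (windowMat ρ f g m (m + k - 1) X).det =
      (Real.exp (sumStep ρ (fun j => f (m + j)) (fun j => g (m + j)) X k) : ℂ) := by
  induction k generalizing m X with
  | zero =>
    have : IsEmpty (Finset.Icc m (m + (0 : ℕ) - 1) × Fin N) := by
      refine ⟨fun p => ?_⟩
      have := Finset.mem_Icc.mp p.1.2
      simp only [Nat.cast_zero] at this
      omega
    rw [Matrix.det_isEmpty]
    simp [sumStep]
  | succ k ih =>
    have hs : ∀ u : ℤ → Mat N K, (fun j => u (m + 1 + j)) = fun j => u (m + (j + 1)) := fun u =>
      funext fun j => congrArg u (by ring)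
    have hn : m + ((k + 1 : ℕ) : ℤ) - 1 = m + 1 + k - 1 := by push_cast; ring
    rw [det_windowMat_eq_mul hρ f g (by push_cast; omega) hX, hn, ih _ (recMap_nonneg hρ _ _ hX),
      det_eq_exp_logDet (schurMat_posDef hρ _ _ hX), logDet_schurMat hρ _ _ hX, sumStep_succ',
      Real.exp_add, Complex.ofReal_mul, add_zero, hs, hs]

lemma one_add_blockH_mul (f g : ℤ → Mat N K) (m n : ℤ) :
    1 + (ρ : ℂ) • (blockH f g m n * (blockH f g m n)ᴴ) = windowMat ρ f g m n 1 := by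
  have hH : ∀ (i : ℤ) (a : Fin N) (c : ℤ) (k : Fin K),
      (if c = i - 1 then f i a k else if c = i then g i a k else 0) =
        (if c = i - 1 then f i a k else 0) + (if c = i then g i a k else 0) := by
    intro i a c k
    split_ifs <;> first | omega | simp
  ext ⟨⟨i, hi⟩, a⟩ ⟨⟨j, hj⟩, b⟩
  have hi' := Finset.mem_Icc.mp hi
  have hj' := Finset.mem_Icc.mp hj
  have hm1 : i - 1 ∈ Finset.Icc (m - 1) n := by rw [Finset.mem_Icc]; omega
  have hm2 : i ∈ Finset.Icc (m - 1) n := by rw [Finset.mem_Icc]; omega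
  have hprod : (blockH f g m n * (blockH f g m n)ᴴ) (⟨i, hi⟩, a) (⟨j, hj⟩, b) =
      ∑ k, (f i a k * ((if i - 1 = j - 1 then star (f j b k) else 0) +
        (if i - 1 = j then star (g j b k) else 0)) +
      g i a k * ((if i = j - 1 then star (f j b k) else 0) +
        (if i = j then star (g j b k) else 0))) := by
    rw [Matrix.mul_apply, Fintype.sum_prod_type_right]
    refine Finset.sum_congr rfl fun k _ => ?_
    simp only [Matrix.conjTranspose_apply, blockH, Matrix.of_apply, hH]
    rw [Finset.sum_coe_sort (Finset.Icc (m - 1) n) (fun c : ℤ =>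
      ((if c = i - 1 then f i a k else 0) + (if c = i then g i a k else 0)) *
      star ((if c = j - 1 then f j b k else 0) + (if c = j then g j b k else 0)))]
    simp only [add_mul, Finset.sum_add_distrib, ite_mul, zero_mul, Finset.sum_ite_eq', hm1, hm2,
      if_true, star_add, apply_ite star, star_zero]
  rw [Matrix.add_apply, Matrix.smul_apply, hprod]
  simp only [windowMat, tridiag, Matrix.submatrix_apply, Matrix.of_apply, ite_self]
  by_cases h1 : i = j
  · subst h1
    have h2 : ¬ i - 1 = i := by omega
    have h3 : ¬ i = i - 1 := by omega
    simp only [if_true, h2, h3, if_false, add_zero, zero_add, schurMat, innerMat_eq,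
      Matrix.add_apply, Matrix.smul_apply, Matrix.mul_apply, Matrix.conjTranspose_apply,
      Matrix.mul_one, Finset.sum_add_distrib, smul_add, Matrix.one_apply, Prod.mk.injEq, true_and,
      Complex.coe_smul]
    ring
  · have h2 : ¬ i - 1 = j - 1 := by omega
    have h3 : (i - 1 = j) ↔ (i = j + 1) := by omega
    have h4 : (i = j - 1) ↔ (j = i + 1) := by omega
    simp only [h1, h2, h3, h4, if_false, zero_add, add_zero, Matrix.one_apply, Prod.mk.injEq,
      Subtype.mk.injEq, false_and]
    by_cases h5 : j = i + 1
    · have h6 : ¬ i = j + 1 := by omega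
      subst h5
      simp [h6, Matrix.mul_apply]
    · by_cases h6 : i = j + 1
      · subst h6
        simp [h5, Matrix.mul_apply]
      · simp [h5, h6]

lemma blockLogDet_eq_sumStep (hρ : 0 ≤ ρ) (f g : ℤ → Mat N K) (m : ℤ) (k : ℕ) :
    blockLogDet ρ f g m (m + k - 1) =
      sumStep ρ (fun j => f (m + j)) (fun j => g (m + j)) 1 k := by
  rw [blockLogDet, one_add_blockH_mul]
  exact logDet_of_det_eq_exp (det_windowMat hρ f g k m zero_le_one)

end BlockDeterminant


section Birkhoff

/-! ### The pointwise ergodic theorem -/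

variable {α : Type*}

/-- The running maxima `max_{1 ≤ k ≤ n + 1} ∑_{i < k} g (T^i x)` of the Birkhoff sums, defined by
their recursion in `n`. -/
noncomputable def maxBirkhoff (T : α → α) (g : α → ℝ) : ℕ → α → ℝ
  | 0 => g
  | n + 1 => fun x => g x + max 0 (maxBirkhoff T g n (T x))

lemma maxBirkhoff_mono (T : α → α) (g : α → ℝ) (x : α) : Monotone fun n => maxBirkhoff T g n x := by
  refine monotone_nat_of_le_succ fun n => ?_
  induction n generalizing x with
  | zero => simp [maxBirkhoff]
  | succ n ih =>
    simp only [maxBirkhoff] at ih ⊢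
    exact add_le_add_right (max_le_max le_rfl (ih (T x))) _

lemma birkhoffSum_le_maxBirkhoff (T : α → α) (g : α → ℝ) (n : ℕ) (x : α) :
    birkhoffSum T g (n + 1) x ≤ maxBirkhoff T g n x := by
  induction n generalizing x with
  | zero => simp [maxBirkhoff]
  | succ n ih =>
    rw [birkhoffSum_succ', maxBirkhoff]
    exact add_le_add_right ((ih (T x)).trans (le_max_right _ _)) _

variable [MeasurableSpace α] {μ : Measure α} {T : α → α}

lemma measurable_maxBirkhoff (hT : Measurable T) {g : α → ℝ} (hg : Measurable g) (n : ℕ) :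
    Measurable (maxBirkhoff T g n) := by
  induction n with
  | zero => exact hg
  | succ n ih => exact hg.add (measurable_const.max (ih.comp hT))

lemma integrable_maxBirkhoff (hT : MeasurePreserving T μ μ) {g : α → ℝ}
    (hg : Integrable g μ) (n : ℕ) : Integrable (maxBirkhoff T g n) μ := by
  induction n with
  | zero => exact hg
  | succ n ih =>
    have h := (hT.integrable_comp_of_integrable ih).pos_part
    simp only [Function.comp_apply] at h
    exact hg.add (by simpa only [max_comm] using h)

/-- A function of negative mean has Birkhoff sums bounded above. The set where they are unbounded
is invariant; if it had full measure, then integrating `M_{n+1} - M_n ∘ T`, which decreases to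
`g` there and has nonnegative integral, would give `0 ≤ ∫ g`. -/
lemma ae_birkhoffSum_bddAbove [IsProbabilityMeasure μ] (hT : Ergodic T μ) {g : α → ℝ}
    (hgm : Measurable g) (hg : Integrable g μ) (hneg : ∫ x, g x ∂μ < 0) :
    ∀ᵐ x ∂μ, ∃ B, ∀ n, birkhoffSum T g n x ≤ B := by
  set M := maxBirkhoff T g with hM
  have hmp := hT.toMeasurePreserving
  set A : Set α := {x | ∀ B : ℕ, ∃ n, (B : ℝ) < M n x} with hA
  have hAm : MeasurableSet A := by
    have : A = ⋂ B : ℕ, ⋃ n, {x | (B : ℝ) < M n x} := by ext; simp [hA]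
    rw [this]
    exact MeasurableSet.iInter fun B => MeasurableSet.iUnion fun n =>
      measurableSet_lt measurable_const (measurable_maxBirkhoff hmp.measurable hgm n)
  have hinv : T ⁻¹' A = A := by
    ext x
    simp only [hA, Set.mem_preimage, Set.mem_ofPred_eq]
    constructor
    · intro h B
      obtain ⟨B', hB'⟩ := exists_nat_ge ((B : ℝ) - g x)
      obtain ⟨n, hn⟩ := h B'
      refine ⟨n + 1, ?_⟩
      have := le_max_right 0 (M n (T x))
      simp only [hM, maxBirkhoff] at hn this ⊢
      linarith
    · intro h B
      obtain ⟨B', hB'⟩ := exists_nat_ge ((B : ℝ) + g x)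
      obtain ⟨n, hn⟩ := h B'
      refine ⟨n, ?_⟩
      have h1 : (B' : ℝ) < M (n + 1) x := hn.trans_le (maxBirkhoff_mono T g x (Nat.le_succ n))
      simp only [hM, maxBirkhoff] at h1 ⊢
      have h2 : (0 : ℝ) ≤ B := Nat.cast_nonneg B
      rcases max_cases 0 (maxBirkhoff T g n (T x)) with h | h <;> linarith
  have hAnull : ∀ᵐ x ∂μ, x ∉ A := by
    rcases hT.toPreErgodic.ae_mem_or_ae_notMem hAm hinv with h | h
    · exfalso
      have hint : ∀ n, Integrable (M n) μ := integrable_maxBirkhoff hmp hg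
      have hintT : ∀ n, Integrable (fun x => M n (T x)) μ := fun n =>
        hmp.integrable_comp_of_integrable (hint n)
      have hpos : ∀ n, 0 ≤ ∫ x, (M (n + 1) x - M n (T x)) ∂μ := by
        intro n
        rw [integral_sub (hint _) (hintT n)]
        have h1 : ∫ x, M n (T x) ∂μ = ∫ x, M n x ∂μ := by
          rw [← integral_map hmp.measurable.aemeasurable
            (by rw [hmp.map_eq]; exact (hint n).aestronglyMeasurable), hmp.map_eq]
        rw [h1, sub_nonneg]
        exact integral_mono (hint n) (hint (n + 1))
          fun x => maxBirkhoff_mono T g x (Nat.le_succ n)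
      have heq : ∀ n x, M (n + 1) x - M n (T x) = g x + max 0 (-M n (T x)) := fun n x => by
        have h1 : M (n + 1) x = g x + max 0 (M n (T x)) := rfl
        rw [h1]
        rcases max_cases 0 (M n (T x)) with h | h <;>
          rcases max_cases 0 (-M n (T x)) with h' | h' <;> linarith
      have hlim : Tendsto (fun n => ∫ x, (M (n + 1) x - M n (T x)) ∂μ) atTop
          (𝓝 (∫ x, g x ∂μ)) := by
        refine tendsto_integral_of_dominated_convergence (fun x => |g x| + |g (T x)|)
          (fun n => ((hint _).sub (hintT n)).aestronglyMeasurable)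
          (hg.abs.add (hmp.integrable_comp_of_integrable hg).abs) (fun n => ?_) ?_
        · refine Eventually.of_forall fun x => ?_
          rw [heq, Real.norm_eq_abs]
          refine (abs_add_le _ _).trans (add_le_add_right ?_ _)
          rw [abs_of_nonneg (le_max_left _ _)]
          refine max_le (abs_nonneg _) ?_
          have h1 : g (T x) ≤ M n (T x) := maxBirkhoff_mono T g (T x) (Nat.zero_le n)
          exact (neg_le_neg h1).trans (neg_le_abs _)
        · filter_upwards [h] with x hx
          rw [← hinv] at hx
          obtain ⟨n0, hn0⟩ := hx 0
          refine tendsto_const_nhds.congr' ?_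
          filter_upwards [eventually_ge_atTop n0] with n hn
          have h1 : M n0 (T x) ≤ M n (T x) := maxBirkhoff_mono T g (T x) hn
          rw [Nat.cast_zero] at hn0
          rw [heq, max_eq_left (by linarith), add_zero]
      exact absurd (ge_of_tendsto' hlim hpos) (not_le.mpr hneg)
    · exact h
  filter_upwards [hAnull] with x hx
  simp only [hA, Set.mem_ofPred_eq, not_forall, not_exists, not_lt] at hx
  obtain ⟨B, hB⟩ := hx
  refine ⟨B, fun n => ?_⟩
  cases n with
  | zero => simp
  | succ n => exact (birkhoffSum_le_maxBirkhoff T g n x).trans (hB n)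

lemma ae_eventually_birkhoffSum_le [IsProbabilityMeasure μ] (hT : Ergodic T μ) {g : α → ℝ}
    (hgm : Measurable g) (hg : Integrable g μ) {ε : ℝ} (hε : 0 < ε) :
    ∀ᵐ x ∂μ, ∀ᶠ n : ℕ in atTop, birkhoffSum T g n x ≤ n * ((∫ x, g x ∂μ) + ε) := by
  set c := (∫ x, g x ∂μ) + ε / 2 with hc
  have h := ae_birkhoffSum_bddAbove hT (g := fun x => g x - c) (hgm.sub_const c)
    (hg.sub (integrable_const c)) (by
      rw [integral_sub hg (integrable_const c), integral_const]
      simp [hc, hε])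
  filter_upwards [h] with x hx
  obtain ⟨B, hB⟩ := hx
  have h1 : ∀ᶠ n : ℕ in atTop, B / (ε / 2) ≤ n :=
    tendsto_natCast_atTop_atTop.eventually_ge_atTop _
  filter_upwards [h1] with n hn
  have h2 := hB n
  rw [div_le_iff₀ (by positivity)] at hn
  have h3 : birkhoffSum T (fun x => g x - c) n x = birkhoffSum T g n x - n * c := by
    simp [birkhoffSum, Finset.sum_sub_distrib]
  rw [h3, hc] at h2
  nlinarith

/-- **Birkhoff's pointwise ergodic theorem** for an ergodic transformation of a probability
space. -/
theorem ae_tendsto_birkhoffSum_div [IsProbabilityMeasure μ] (hT : Ergodic T μ) {g : α → ℝ}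
    (hgm : Measurable g) (hg : Integrable g μ) :
    ∀ᵐ x ∂μ, Tendsto (fun n : ℕ => birkhoffSum T g n x / n) atTop (𝓝 (∫ x, g x ∂μ)) := by
  have hup : ∀ᵐ x ∂μ, ∀ k : ℕ, ∀ᶠ n : ℕ in atTop,
      birkhoffSum T g n x ≤ n * ((∫ x, g x ∂μ) + 1 / ((k : ℝ) + 1)) :=
    ae_all_iff.mpr fun k => ae_eventually_birkhoffSum_le hT hgm hg (by positivity)
  have hlow : ∀ᵐ x ∂μ, ∀ k : ℕ, ∀ᶠ n : ℕ in atTop,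
      birkhoffSum T (fun x => -g x) n x ≤ n * ((∫ x, -g x ∂μ) + 1 / ((k : ℝ) + 1)) :=
    ae_all_iff.mpr fun k => ae_eventually_birkhoffSum_le hT hgm.neg hg.neg (by positivity)
  filter_upwards [hup, hlow] with x h1 h2
  rw [Metric.tendsto_atTop']
  intro ε hε
  obtain ⟨k, hk⟩ := exists_nat_one_div_lt hε
  obtain ⟨n0, hn0⟩ := eventually_atTop.mp ((h1 k).and (h2 k))
  refine ⟨n0, fun n hn => ?_⟩
  obtain ⟨h3, h4⟩ := hn0 n hn.le
  have hnpos : (0 : ℝ) < n := by exact_mod_cast (Nat.zero_le n0).trans_lt hn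
  have h5 : birkhoffSum T (fun x => -g x) n x = -birkhoffSum T g n x := by
    simp [birkhoffSum]
  rw [h5, integral_neg] at h4
  rw [Real.dist_eq]
  refine lt_of_le_of_lt ?_ hk
  rw [abs_le, neg_le_sub_iff_le_add, sub_le_iff_le_add, ← sub_le_iff_le_add,
    le_div_iff₀ hnpos, div_le_iff₀ hnpos]
  constructor <;> nlinarith

end Birkhoff


section TwoSidedMeans

/-! ### Means over windows of a two-sided sequence -/

/-- The sums of the two-sided real sequence `u` over windows of `k` consecutive integers starting
at `m` are `k L + o(|m| + k)`. -/
def HasWindowMean (u : ℤ → ℝ) (L : ℝ) : Prop :=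
  ∀ ε > 0, ∃ B, ∀ (m : ℤ) (k : ℕ),
    |∑ j ∈ Finset.range k, u (m + j) - k * L| ≤ ε * (|(m : ℝ)| + k) + B

/-- The partial sums of `v` in both directions: the sum of `v` over `0, …, n - 1` for `n ≥ 0`, and
minus the sum over `n, …, -1` for `n < 0`. -/
def signedSum (v : ℤ → ℝ) : ℤ → ℝ
  | Int.ofNat n => ∑ k ∈ Finset.range n, v k
  | Int.negSucc n => -∑ k ∈ Finset.range (n + 1), v (Int.negSucc k)

lemma signedSum_add_one (v : ℤ → ℝ) (n : ℤ) : signedSum v (n + 1) = signedSum v n + v n := by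
  match n with
  | Int.ofNat n =>
    show signedSum v (Int.ofNat (n + 1)) = _
    simp [signedSum, Finset.sum_range_succ]
  | Int.negSucc 0 =>
    show signedSum v (Int.ofNat 0) = _
    simp [signedSum]
  | Int.negSucc (n + 1) =>
    show signedSum v (Int.negSucc n) = _
    simp only [signedSum]
    rw [Finset.sum_range_succ _ (n + 1)]
    ring

lemma sum_range_eq_signedSum_sub (v : ℤ → ℝ) (m : ℤ) (k : ℕ) :
    ∑ j ∈ Finset.range k, v (m + j) = signedSum v (m + k) - signedSum v m := by
  induction k with
  | zero => simp
  | succ k ih =>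
    have : m + ((k + 1 : ℕ) : ℤ) = m + k + 1 := by push_cast; ring
    rw [Finset.sum_range_succ, ih, this, signedSum_add_one]
    ring

lemma exists_bound_of_tendsto_div {s : ℕ → ℝ} (h : Tendsto (fun n : ℕ => s n / n) atTop (𝓝 0))
    {ε : ℝ} (hε : 0 < ε) : ∃ B, 0 ≤ B ∧ ∀ n : ℕ, |s n| ≤ ε * n + B := by
  obtain ⟨n0, hn0⟩ := Metric.tendsto_atTop.mp h ε hε
  refine ⟨∑ k ∈ Finset.range (n0 + 1), |s k|, Finset.sum_nonneg fun _ _ => abs_nonneg _,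
    fun n => ?_⟩
  rcases lt_or_ge n (n0 + 1) with hn | hn
  · have := Finset.single_le_sum (f := fun k => |s k|) (fun i _ => abs_nonneg (s i))
      (Finset.mem_range.mpr hn)
    have h2 : 0 ≤ ε * n := by positivity
    linarith
  · have h1 := hn0 n (by omega)
    have hpos : (0 : ℝ) < n := by exact_mod_cast (Nat.succ_pos n0).trans_le hn
    rw [Real.dist_eq, sub_zero, abs_div, abs_of_pos hpos, div_lt_iff₀ hpos] at h1
    have := Finset.sum_nonneg (s := Finset.range (n0 + 1)) (f := fun k => |s k|)
      fun i _ => abs_nonneg (s i)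
    linarith

/-- Windows far from the origin are differences of windows that start at the origin. -/
lemma hasWindowMean_of_tendsto {u : ℤ → ℝ} {L : ℝ}
    (hf : Tendsto (fun n : ℕ => (∑ k ∈ Finset.range n, u k) / n) atTop (𝓝 L))
    (hb : Tendsto (fun n : ℕ => (∑ k ∈ Finset.range n, u (-k)) / n) atTop (𝓝 L)) :
    HasWindowMean u L := by
  have aux : ∀ w : ℕ → ℝ, Tendsto (fun n : ℕ => (∑ k ∈ Finset.range n, w k) / n) atTop (𝓝 L) →
      Tendsto (fun n : ℕ => (∑ k ∈ Finset.range n, (w k - L)) / n) atTop (𝓝 0) := by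
    intro w hw
    rw [← sub_self L]
    refine (hw.sub_const L).congr' ?_
    filter_upwards [eventually_gt_atTop 0] with n hn
    have : (n : ℝ) ≠ 0 := by exact_mod_cast hn.ne'
    rw [Finset.sum_sub_distrib]
    simp only [Finset.sum_const, Finset.card_range, nsmul_eq_mul]
    field_simp
  set v : ℤ → ℝ := fun n => u n - L with hv
  intro ε hε
  obtain ⟨B1, hB1, h1⟩ := exists_bound_of_tendsto_div (aux _ hf) (half_pos hε)
  obtain ⟨B2, hB2, h2⟩ := exists_bound_of_tendsto_div (aux _ hb) (half_pos hε)
  have hA : ∀ n : ℤ, |signedSum v n| ≤ ε / 2 * |(n : ℝ)| + (B1 + B2 + ε + |v 0|) := by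
    intro n
    match n with
    | Int.ofNat n =>
      have := h1 n
      have h3 := abs_nonneg (v 0)
      simp only [signedSum, Int.ofNat_eq_natCast, Int.cast_natCast, Nat.abs_cast]
      linarith
    | Int.negSucc n =>
      have h3 := h2 (n + 2)
      have h4 : ∑ k ∈ Finset.range (n + 2), (u (-(k : ℤ)) - L) =
          ∑ k ∈ Finset.range (n + 1), v (Int.negSucc k) + v 0 := by
        rw [Finset.sum_range_succ']
        simp [hv, Int.negSucc_eq]
      rw [h4] at h3
      have h5 : |((Int.negSucc n : ℤ) : ℝ)| = n + 1 := by
        rw [Int.cast_negSucc, abs_neg, Nat.abs_cast]; push_cast; rfl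
      rw [h5]
      simp only [signedSum, abs_neg]
      have h6 := abs_sub_abs_le_abs_sub (∑ k ∈ Finset.range (n + 1), v (Int.negSucc k)) (-v 0)
      rw [sub_neg_eq_add, abs_neg] at h6
      push_cast at h3
      linarith
  refine ⟨2 * (B1 + B2 + ε + |v 0|), fun m k => ?_⟩
  have h3 : ∑ j ∈ Finset.range k, u (m + j) - k * L = signedSum v (m + k) - signedSum v m := by
    rw [← sum_range_eq_signedSum_sub]
    simp [hv, Finset.sum_sub_distrib]
  rw [h3]
  have h4 := abs_sub (signedSum v (m + k)) (signedSum v m)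
  have h5 := hA (m + k)
  have h6 := hA m
  have h7 : |((m + k : ℤ) : ℝ)| ≤ |(m : ℝ)| + k := by
    push_cast
    exact (abs_add_le _ _).trans (by rw [Nat.abs_cast])
  nlinarith

lemma HasWindowMean.abs_sub_le {u : ℤ → ℝ} {L : ℝ} (h : HasWindowMean u L) {ε : ℝ} (hε : 0 < ε) :
    ∃ B, ∀ n : ℤ, |u n - L| ≤ ε * |(n : ℝ)| + B := by
  obtain ⟨B, hB⟩ := h ε hε
  refine ⟨B + ε, fun n => ?_⟩
  have := hB n 1
  simp only [Finset.sum_range_one, Nat.cast_zero, add_zero, Nat.cast_one, one_mul] at this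
  linarith

lemma HasWindowMean.exists_le {u : ℤ → ℝ} {L : ℝ} (h : HasWindowMean u L) (n : ℤ) :
    ∃ k ≤ n, u k ≤ L + 1 := by
  by_contra! hcon
  obtain ⟨B, hB⟩ := h (1 / 4) (by norm_num)
  obtain ⟨k, hk⟩ := exists_nat_gt (|(n : ℝ)| + 2 * B + 1)
  have h1 := hB (n - k) k
  have h2 : ∑ j ∈ Finset.range k, (L + 1) ≤ ∑ j ∈ Finset.range k, u (n - k + j) :=
    Finset.sum_le_sum fun j hj => (hcon _ (by have := Finset.mem_range.mp hj; omega)).le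
  rw [Finset.sum_const, Finset.card_range, nsmul_eq_mul] at h2
  have h3 := (le_abs_self _).trans h1
  have h4 : |((n - k : ℤ) : ℝ)| ≤ |(n : ℝ)| + k := by
    push_cast
    exact (abs_sub _ _).trans (by rw [Nat.abs_cast])
  have h5 := abs_nonneg (n : ℝ)
  nlinarith

lemma tendsto_div_of_window_bound {S : ℤ × ℤ → ℝ} {L : ℝ} {N : ℕ} {l : Filter (ℤ × ℤ)}
    (hl : l ≤ longWindows)
    (h : ∀ ε > 0, ∃ B, ∀ᶠ p in l, |S p - ((p.2 - p.1 + 1 : ℤ) : ℝ) * L| ≤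
      ε * ((p.2 - p.1 + 1 : ℤ) : ℝ) + B) :
    Tendsto (fun p : ℤ × ℤ => 1 / (((p.2 - p.1 + 1 : ℤ) : ℝ) * N) * S p) l
      (𝓝 (1 / (N : ℝ) * L)) := by
  have hlen : Tendsto (fun p : ℤ × ℤ => p.2 - p.1) l atTop := tendsto_comap.mono_left hl
  have key : Tendsto (fun p : ℤ × ℤ => S p / ((p.2 - p.1 + 1 : ℤ) : ℝ)) l (𝓝 L) := by
    rw [Metric.tendsto_nhds]
    intro ε hε
    obtain ⟨B, hB⟩ := h (ε / 2) (half_pos hε)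
    obtain ⟨n0, hn0⟩ := exists_nat_gt (B / (ε / 2))
    rw [div_lt_iff₀ (half_pos hε)] at hn0
    filter_upwards [hB, hlen.eventually_ge_atTop (n0 : ℤ)] with p hp hlp
    set k : ℝ := ((p.2 - p.1 + 1 : ℤ) : ℝ) with hk
    have hkn : (n0 : ℝ) + 1 ≤ k := by
      rw [hk]; exact_mod_cast (by omega : (n0 : ℤ) + 1 ≤ p.2 - p.1 + 1)
    have hk0 : 0 < k := by linarith [(Nat.cast_nonneg n0 : (0 : ℝ) ≤ n0)]
    have h1 : S p / k - L = (S p - k * L) / k := by field_simp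
    rw [Real.dist_eq, h1, abs_div, abs_of_pos hk0, div_lt_iff₀ hk0]
    nlinarith
  have := key.const_mul (1 / (N : ℝ))
  refine this.congr fun p => ?_
  rw [one_div_mul_eq_div, one_div_mul_eq_div, div_div]

end TwoSidedMeans


section Measurability

/-! ### Measurability -/

instance instBorelSpaceMat (a b : ℕ) : BorelSpace (Matrix (Fin a) (Fin b) ℂ) :=
  inferInstanceAs (BorelSpace (Fin a → Fin b → ℂ))

variable {N K : ℕ} {ρ : ℝ} {α : Type*} [MeasurableSpace α]

lemma measurable_mat_iff {a b : ℕ} {A : α → Mat a b} :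
    Measurable A ↔ ∀ i j, Measurable fun x => A x i j :=
  ⟨fun h i j => measurable_pi_iff.mp (measurable_pi_iff.mp h i) j,
    fun h => measurable_pi_iff.mpr fun i => measurable_pi_iff.mpr fun j => h i j⟩

lemma measurable_matMul {a b c : ℕ} {A : α → Mat a b} {B : α → Mat b c} (hA : Measurable A)
    (hB : Measurable B) : Measurable fun x => A x * B x := by
  rw [measurable_mat_iff] at *
  intro i j
  simp only [Matrix.mul_apply]
  exact Finset.measurable_sum _ fun k _ => (hA i k).mul (hB k j)

lemma measurable_conjTranspose {a b : ℕ} {A : α → Mat a b} (hA : Measurable A) :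
    Measurable fun x => (A x)ᴴ := by
  rw [measurable_mat_iff] at *
  intro i j
  exact Complex.continuous_conj.measurable.comp (hA j i)

lemma measurable_one_add_smul {a : ℕ} {A : α → Mat a a} (hA : Measurable A) (c : ℂ) :
    Measurable fun x => 1 + c • A x := by
  rw [measurable_mat_iff] at *
  intro i j
  exact ((hA i j).const_mul c).const_add _

lemma measurable_det {a : ℕ} {A : α → Mat a a} (hA : Measurable A) :
    Measurable fun x => (A x).det := by
  rw [measurable_mat_iff] at hA
  simp only [Matrix.det_apply]
  exact Finset.measurable_sum _ fun σ _ =>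
    (Finset.measurable_prod _ fun i _ => hA (σ i) i).const_smul _

lemma measurable_matInv {a : ℕ} {A : α → Mat a a} (hA : Measurable A) :
    Measurable fun x => (A x)⁻¹ := by
  rw [measurable_mat_iff]
  intro i j
  simp only [Matrix.inv_def, Ring.inverse_eq_inv', Matrix.smul_apply, smul_eq_mul,
    Matrix.adjugate_apply]
  refine (measurable_det hA).inv.mul (measurable_det ?_)
  rw [measurable_mat_iff] at *
  intro k l
  simp only [Matrix.updateRow_apply]
  split_ifs
  · exact measurable_const
  · exact hA k l

lemma measurable_logDet {a : ℕ} {A : α → Mat a a} (hA : Measurable A) :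
    Measurable fun x => logDet (A x) :=
  Real.measurable_log.comp (Complex.measurable_re.comp (measurable_det hA))

lemma measurable_innerMat {F : α → Mat N K} {W : α → Mat K K} (hF : Measurable F)
    (hW : Measurable W) : Measurable fun x => innerMat ρ (F x) (W x) :=
  measurable_one_add_smul (measurable_matMul (measurable_matMul hF hW)
    (measurable_conjTranspose hF)) _

lemma measurable_recMap {F G : α → Mat N K} {W : α → Mat K K} (hF : Measurable F)
    (hG : Measurable G) (hW : Measurable W) : Measurable fun x => recMap ρ (F x) (G x) (W x) :=
  measurable_matInv (measurable_one_add_smul (measurable_matMul (measurable_matMul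
    (measurable_conjTranspose hG) (measurable_matInv (measurable_innerMat hF hW))) hG) _)

lemma measurable_stepLogDet {F G : α → Mat N K} {W : α → Mat K K} (hF : Measurable F)
    (hG : Measurable G) (hW : Measurable W) :
    Measurable fun x => stepLogDet ρ (F x) (G x) (W x) :=
  (measurable_logDet (measurable_innerMat hF hW)).sub (measurable_logDet (measurable_recMap hF hG hW))

lemma measurable_recursionFrom {F G : ℤ → α → Mat N K} (hF : ∀ n, Measurable (F n))
    (hG : ∀ n, Measurable (G n)) (X : Mat K K) (j : ℕ) :
    Measurable fun x => recursionFrom ρ (fun n => F n x) (fun n => G n x) X j := by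
  induction j with
  | zero => exact measurable_const
  | succ j ih => exact measurable_recMap (hF j) (hG j) ih

lemma measurable_sumStep {F G : ℤ → α → Mat N K} (hF : ∀ n, Measurable (F n))
    (hG : ∀ n, Measurable (G n)) (X : Mat K K) (k : ℕ) :
    Measurable fun x => sumStep ρ (fun n => F n x) (fun n => G n x) X k :=
  Finset.measurable_sum _ fun j _ =>
    measurable_stepLogDet (hF j) (hG j) (measurable_recursionFrom hF hG X j)

lemma measurable_pastLimit (hρ : 0 ≤ ρ) {F G : ℤ → α → Mat N K} (hF : ∀ n, Measurable (F n))
    (hG : ∀ n, Measurable (G n)) (n : ℤ) :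
    Measurable fun x => pastLimit ρ (fun n => F n x) (fun n => G n x) n := by
  have h : ∀ (k : ℕ) (n : ℤ),
      Measurable fun x => pullback ρ (fun n => F n x) (fun n => G n x) n k := by
    intro k
    induction k with
    | zero => exact fun _ => measurable_const
    | succ k ih => exact fun n => measurable_recMap (hF n) (hG n) (ih (n - 1))
  exact measurable_of_tendsto_metrizable (fun k => h k n)
    (tendsto_pi_nhds.mpr fun x => tendsto_pullback hρ _ _ n)

end Measurability

section PathSpace

/-! ### Stationary functionals on path space -/

variable {S : Type*} [MeasurableSpace S]

/-- The shift as a measurable automorphism of path space. -/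
def shiftEquiv (S : Type*) [MeasurableSpace S] : (ℤ → S) ≃ᵐ (ℤ → S) where
  toFun := shift S
  invFun := fun x n => x (n - 1)
  left_inv := fun x => by ext n; simp [shift]
  right_inv := fun x => by ext n; simp [shift]
  measurable_toFun := measurable_pi_lambda _ fun n => measurable_pi_apply (n + 1)
  measurable_invFun := measurable_pi_lambda _ fun n => measurable_pi_apply (n - 1)

variable {μ : Measure (ℤ → S)} {u : ℤ → (ℤ → S) → ℝ}

lemma integral_shift_eq (hμ : MeasurePreserving (shift S) μ μ)
    (hu : ∀ n y, u n (shift S y) = u (n + 1) y) (n : ℤ) : ∫ y, u n y ∂μ = ∫ y, u 0 y ∂μ := by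
  have h : ∀ n, ∫ y, u (n + 1) y ∂μ = ∫ y, u n y ∂μ := fun n => by
    simp only [← hu]
    exact MeasurePreserving.integral_comp hμ (shiftEquiv S).measurableEmbedding (u n)
  induction n using Int.induction_on with
  | zero => rfl
  | succ n ih => rw [h, ih]
  | pred n ih => rw [← ih, ← h (-(n : ℤ) - 1), sub_add_cancel]

lemma integrable_shift (hμ : MeasurePreserving (shift S) μ μ)
    (hu : ∀ n y, u n (shift S y) = u (n + 1) y) (h0 : Integrable (u 0) μ) (n : ℤ) :
    Integrable (u n) μ := by
  have h : ∀ n, Integrable (u (n + 1)) μ ↔ Integrable (u n) μ := fun n => by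
    have h1 : u (n + 1) = u n ∘ shift S := funext fun y => (hu n y).symm
    rw [h1]
    exact MeasurePreserving.integrable_comp_emb hμ (shiftEquiv S).measurableEmbedding
  induction n using Int.induction_on with
  | zero => exact h0
  | succ n ih => exact (h _).mpr ih
  | pred n ih => exact (h _).mp (by rwa [sub_add_cancel])

/-- The ergodic theorem for the shift and for its inverse gives the means over all windows of a
stationary sequence of functionals. -/
lemma ae_hasWindowMean [IsProbabilityMeasure μ] (hμ : Ergodic (shift S) μ)
    (hu : ∀ n y, u n (shift S y) = u (n + 1) y) (hm : Measurable (u 0))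
    (h0 : Integrable (u 0) μ) : ∀ᵐ y ∂μ, HasWindowMean (fun n => u n y) (∫ y, u 0 y ∂μ) := by
  have hs : Ergodic (shiftEquiv S).symm μ := Ergodic.symm (e := shiftEquiv S) hμ
  have hsymm : ∀ n y, u n ((shiftEquiv S).symm y) = u (n - 1) y := fun n y => by
    have h1 := hu (n - 1) ((shiftEquiv S).symm y)
    have h2 : shift S ((shiftEquiv S).symm y) = y := (shiftEquiv S).apply_symm_apply y
    rw [h2, sub_add_cancel] at h1
    exact h1.symm
  have hf : ∀ (k : ℕ) y n, u n ((shift S)^[k] y) = u (n + k) y := by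
    intro k
    induction k with
    | zero => simp
    | succ k ih =>
      intro y n
      rw [Function.iterate_succ_apply, ih, hu]
      push_cast
      rw [add_assoc]
  have hb : ∀ (k : ℕ) y n, u n ((shiftEquiv S).symm^[k] y) = u (n - k) y := by
    intro k
    induction k with
    | zero => simp
    | succ k ih =>
      intro y n
      rw [Function.iterate_succ_apply, ih, hsymm]
      push_cast
      rw [sub_sub]
  filter_upwards [ae_tendsto_birkhoffSum_div hμ hm h0, ae_tendsto_birkhoffSum_div hs hm h0]
    with y h1 h2
  refine hasWindowMean_of_tendsto (h1.congr fun n => ?_) (h2.congr fun n => ?_)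
  · simp only [birkhoffSum, hf, zero_add]
  · simp only [birkhoffSum, hb, zero_sub]

end PathSpace


section Channel

open scoped MatrixOrder

variable {N K : ℕ} {ρ : ℝ}

/-! ### Functionals of the channel -/

/-- The two-sided solution of the recursion, as a function on path space. -/
noncomputable def pathSol (ρ : ℝ) (y : ℤ → Mat N K × Mat N K) (n : ℤ) : Mat K K :=
  pastLimit ρ (fun k => (y k).1) (fun k => (y k).2) n

/-- The increment of `log det` at time `n` along the two-sided solution. -/
noncomputable def pathInc (ρ : ℝ) (n : ℤ) (y : ℤ → Mat N K × Mat N K) : ℝ :=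
  stepLogDet ρ (y n).1 (y n).2 (pathSol ρ y (n - 1))

/-- The cost `-log det W_n` of starting the recursion at the two-sided solution and not at `I`. -/
noncomputable def pathCost (ρ : ℝ) (n : ℤ) (y : ℤ → Mat N K × Mat N K) : ℝ :=
  -logDet (pathSol ρ y n)

/-- The sum `ρ ‖F_n‖² + ρ ‖G_n‖²`. -/
noncomputable def pathSize (ρ : ℝ) (n : ℤ) (y : ℤ → Mat N K × Mat N K) : ℝ :=
  ρ * ‖(y n).1‖ ^ 2 + ρ * ‖(y n).2‖ ^ 2

lemma pathSol_shift (y : ℤ → Mat N K × Mat N K) (n : ℤ) :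
    pathSol ρ (shift _ y) n = pathSol ρ y (n + 1) :=
  pastLimit_shift (fun k => (y k).1) (fun k => (y k).2) n

lemma pathSol_eq_recMap (hρ : 0 ≤ ρ) (y : ℤ → Mat N K × Mat N K) (n : ℤ) :
    pathSol ρ y n = recMap ρ (y n).1 (y n).2 (pathSol ρ y (n - 1)) :=
  pastLimit_eq_recMap hρ _ _ n

lemma pathSol_nonneg (hρ : 0 ≤ ρ) (y : ℤ → Mat N K × Mat N K) (n : ℤ) : 0 ≤ pathSol ρ y n :=
  pastLimit_nonneg hρ _ _ n

lemma pathInc_shift (n : ℤ) (y : ℤ → Mat N K × Mat N K) :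
    pathInc ρ n (shift _ y) = pathInc ρ (n + 1) y := by
  rw [pathInc, pathInc, pathSol_shift, sub_add_cancel, add_sub_cancel_right]; rfl

lemma pathCost_shift (n : ℤ) (y : ℤ → Mat N K × Mat N K) :
    pathCost ρ n (shift _ y) = pathCost ρ (n + 1) y := by
  rw [pathCost, pathCost, pathSol_shift]

lemma pathSize_shift (n : ℤ) (y : ℤ → Mat N K × Mat N K) :
    pathSize ρ n (shift _ y) = pathSize ρ (n + 1) y := rfl

lemma measurable_pathSol (hρ : 0 ≤ ρ) (n : ℤ) :
    Measurable fun y : ℤ → Mat N K × Mat N K => pathSol ρ y n :=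
  measurable_pastLimit hρ (fun k => (measurable_pi_apply k).fst)
    (fun k => (measurable_pi_apply k).snd) n

lemma measurable_pathInc (hρ : 0 ≤ ρ) (n : ℤ) :
    Measurable (pathInc ρ n : (ℤ → Mat N K × Mat N K) → ℝ) :=
  measurable_stepLogDet (measurable_pi_apply n).fst (measurable_pi_apply n).snd
    (measurable_pathSol hρ (n - 1))

lemma measurable_pathCost (hρ : 0 ≤ ρ) (n : ℤ) :
    Measurable (pathCost ρ n : (ℤ → Mat N K × Mat N K) → ℝ) :=
  (measurable_logDet (measurable_pathSol hρ n)).neg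

lemma measurable_pathSize (n : ℤ) : Measurable (pathSize ρ n : (ℤ → Mat N K × Mat N K) → ℝ) :=
  (((measurable_pi_apply n).fst.norm.pow_const 2).const_mul ρ).add
    (((measurable_pi_apply n).snd.norm.pow_const 2).const_mul ρ)

lemma pathCost_nonneg (hρ : 0 ≤ ρ) (n : ℤ) (y : ℤ → Mat N K × Mat N K) : 0 ≤ pathCost ρ n y := by
  rw [pathCost, pathSol_eq_recMap hρ, neg_nonneg]
  exact logDet_recMap_nonpos hρ _ _ (pathSol_nonneg hρ y _)

lemma pathCost_le (hρ : 0 ≤ ρ) (n : ℤ) (y : ℤ → Mat N K × Mat N K) :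
    pathCost ρ n y ≤ K * (ρ * ‖(y n).2‖ ^ 2) := by
  rw [pathCost, pathSol_eq_recMap hρ]
  exact neg_logDet_recMap_le hρ _ _ (pathSol_nonneg hρ y _)

lemma pathInc_eq (hρ : 0 ≤ ρ) (n : ℤ) (y : ℤ → Mat N K × Mat N K) :
    pathInc ρ n y = logDet (innerMat ρ (y n).1 (pathSol ρ y (n - 1))) + pathCost ρ n y := by
  rw [pathInc, stepLogDet, pathCost, ← pathSol_eq_recMap hρ, sub_eq_add_neg]

lemma sumStep_pathSol (hρ : 0 ≤ ρ) (y : ℤ → Mat N K × Mat N K) (m : ℤ) (k : ℕ) :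
    sumStep ρ (fun j => (y (m + j)).1) (fun j => (y (m + j)).2) (pathSol ρ y (m - 1)) k =
      ∑ j ∈ Finset.range k, pathInc ρ (m + j) y := by
  refine Finset.sum_congr rfl fun j _ => ?_
  rw [recursionFrom_of_solution (f := fun k => (y k).1) (g := fun k => (y k).2)
    (pathSol_eq_recMap hρ y) m j, pathInc]
  congr 2
  ring

/-- Up to the cost of the starting point, the log-determinant of a window is the sum of the
stationary increments. -/
lemma sum_pathInc_le_blockLogDet (hρ : 0 ≤ ρ) (y : ℤ → Mat N K × Mat N K) (m : ℤ) (k : ℕ) :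
    ∑ j ∈ Finset.range k, pathInc ρ (m + j) y ≤
      blockLogDet ρ (fun n => (y n).1) (fun n => (y n).2) m (m + k - 1) := by
  rw [blockLogDet_eq_sumStep hρ, ← sumStep_pathSol hρ]
  exact sumStep_mono hρ _ _ (pathSol_nonneg hρ y _) (pastLimit_le_one hρ _ _ _) k

lemma blockLogDet_le_sum_pathInc (hρ : 0 ≤ ρ) (y : ℤ → Mat N K × Mat N K) (m : ℤ) (k : ℕ) :
    blockLogDet ρ (fun n => (y n).1) (fun n => (y n).2) m (m + k - 1) ≤
      ∑ j ∈ Finset.range k, pathInc ρ (m + j) y + pathCost ρ (m - 1) y := by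
  rw [blockLogDet_eq_sumStep hρ, ← sumStep_pathSol hρ]
  have h := sumStep_sub_le hρ (fun j => (y (m + j)).1) (fun j => (y (m + j)).2)
    (pastLimit_posDef hρ (fun k => (y k).1) (fun k => (y k).2) (m - 1))
    (pastLimit_le_one hρ _ _ (m - 1)) k
  rw [logDet_one] at h
  simp only [pathCost, pathSol]
  linarith

lemma measurable_blockLogDet (hρ : 0 ≤ ρ) (m : ℤ) (k : ℕ) :
    Measurable fun y : ℤ → Mat N K × Mat N K =>
      blockLogDet ρ (fun n => (y n).1) (fun n => (y n).2) m (m + k - 1) := by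
  simp only [blockLogDet_eq_sumStep hρ]
  exact measurable_sumStep (F := fun j (y : ℤ → Mat N K × Mat N K) => (y (m + j)).1)
    (G := fun j (y : ℤ → Mat N K × Mat N K) => (y (m + j)).2)
    (fun j => (measurable_pi_apply (m + j)).fst) (fun j => (measurable_pi_apply (m + j)).snd) 1 k

/-! ### Integrability and means -/

variable {μ : Measure (ℤ → Mat N K × Mat N K)}

lemma integrable_pathCost (hρ : 0 ≤ ρ)
    (hG : Integrable (fun y : ℤ → Mat N K × Mat N K => ‖(y 0).2‖ ^ 2) μ) :
    Integrable (pathCost ρ 0) μ := by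
  refine Integrable.mono' ((hG.const_mul ρ).const_mul (K : ℝ))
    (measurable_pathCost hρ 0).aestronglyMeasurable (Eventually.of_forall fun y => ?_)
  rw [Real.norm_eq_abs, abs_of_nonneg (pathCost_nonneg hρ 0 y)]
  exact pathCost_le hρ 0 y

lemma integrable_logDet_innerMat (hρ : 0 ≤ ρ)
    (hF : Integrable (fun y : ℤ → Mat N K × Mat N K => ‖(y 0).1‖ ^ 2) μ) :
    Integrable (fun y => logDet (innerMat ρ (y 0).1 (pathSol ρ y (-1)))) μ := by
  refine Integrable.mono' ((hF.const_mul ρ).const_mul (N : ℝ))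
    (measurable_logDet (measurable_innerMat (measurable_pi_apply 0).fst
      (measurable_pathSol hρ (-1)))).aestronglyMeasurable (Eventually.of_forall fun y => ?_)
  rw [Real.norm_eq_abs, abs_of_nonneg (logDet_innerMat_nonneg hρ _ (pathSol_nonneg hρ y _))]
  exact logDet_innerMat_le hρ _ (pathSol_nonneg hρ y _) (pastLimit_le_one hρ _ _ _)

lemma integrable_pathInc (hρ : 0 ≤ ρ)
    (hF : Integrable (fun y : ℤ → Mat N K × Mat N K => ‖(y 0).1‖ ^ 2) μ)
    (hG : Integrable (fun y : ℤ → Mat N K × Mat N K => ‖(y 0).2‖ ^ 2) μ) :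
    Integrable (pathInc ρ 0) μ := by
  have h : pathInc ρ 0 = fun y : ℤ → Mat N K × Mat N K =>
      logDet (innerMat ρ (y 0).1 (pathSol ρ y (-1))) + pathCost ρ 0 y :=
    funext fun y => by rw [pathInc_eq hρ, zero_sub]
  rw [h]
  exact (integrable_logDet_innerMat hρ hF).add (integrable_pathCost hρ hG)

lemma integral_pathInc (hρ : 0 ≤ ρ)
    (hF : Integrable (fun y : ℤ → Mat N K × Mat N K => ‖(y 0).1‖ ^ 2) μ)
    (hG : Integrable (fun y : ℤ → Mat N K × Mat N K => ‖(y 0).2‖ ^ 2) μ) :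
    ∫ y, pathInc ρ 0 y ∂μ = (∫ y, logDet (innerMat ρ (y 0).1 (pathSol ρ y (-1))) ∂μ) -
      ∫ y, logDet (pathSol ρ y 0) ∂μ := by
  have h := integral_add (integrable_logDet_innerMat hρ hF) (integrable_pathCost hρ hG)
  simp only [pathInc_eq hρ, zero_sub]
  rw [h]
  simp only [pathCost, integral_neg]
  ring

lemma integrable_blockLogDet (hρ : 0 ≤ ρ) (hμ : MeasurePreserving (shift _) μ μ)
    (hF : Integrable (fun y : ℤ → Mat N K × Mat N K => ‖(y 0).1‖ ^ 2) μ)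
    (hG : Integrable (fun y : ℤ → Mat N K × Mat N K => ‖(y 0).2‖ ^ 2) μ) (m : ℤ) (k : ℕ) :
    Integrable (fun y => blockLogDet ρ (fun n => (y n).1) (fun n => (y n).2) m (m + k - 1)) μ := by
  have hI := integrable_shift hμ pathInc_shift (integrable_pathInc hρ hF hG)
  have hC := integrable_shift hμ pathCost_shift (integrable_pathCost hρ hG)
  refine Integrable.mono' ((integrable_finsetSum (Finset.range k)
    fun j _ => hI (m + j)).abs.add (hC (m - 1)))
    (measurable_blockLogDet hρ m k).aestronglyMeasurable (Eventually.of_forall fun y => ?_)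
  have h1 := sum_pathInc_le_blockLogDet hρ y m k
  have h2 := blockLogDet_le_sum_pathInc hρ y m k
  have h3 := pathCost_nonneg hρ (m - 1) y
  rw [Real.norm_eq_abs, abs_le]
  simp only [Pi.add_apply]
  constructor
  · linarith [neg_abs_le (∑ j ∈ Finset.range k, pathInc ρ (m + j) y)]
  · linarith [le_abs_self (∑ j ∈ Finset.range k, pathInc ρ (m + j) y)]

lemma abs_integral_blockLogDet_sub_le (hρ : 0 ≤ ρ) (hμ : MeasurePreserving (shift _) μ μ)
    (hF : Integrable (fun y : ℤ → Mat N K × Mat N K => ‖(y 0).1‖ ^ 2) μ)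
    (hG : Integrable (fun y : ℤ → Mat N K × Mat N K => ‖(y 0).2‖ ^ 2) μ) (m : ℤ) (k : ℕ) :
    |∫ y, blockLogDet ρ (fun n => (y n).1) (fun n => (y n).2) m (m + k - 1) ∂μ -
      k * ∫ y, pathInc ρ 0 y ∂μ| ≤ ∫ y, pathCost ρ 0 y ∂μ := by
  have hI := integrable_shift hμ pathInc_shift (integrable_pathInc hρ hF hG)
  have hC := integrable_shift hμ pathCost_shift (integrable_pathCost hρ hG)
  have hS : Integrable (fun y => ∑ j ∈ Finset.range k, pathInc ρ (m + j) y) μ :=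
    integrable_finsetSum _ fun j _ => hI (m + j)
  have hB := integrable_blockLogDet hρ hμ hF hG m k
  have hsum : ∫ y, ∑ j ∈ Finset.range k, pathInc ρ (m + j) y ∂μ =
      k * ∫ y, pathInc ρ 0 y ∂μ := by
    rw [integral_finsetSum _ fun (j : ℕ) _ => hI (m + j)]
    simp [integral_shift_eq hμ pathInc_shift]
  have h1 := integral_mono hS hB fun y => sum_pathInc_le_blockLogDet hρ y m k
  have h2 := integral_mono hB (hS.add (hC (m - 1))) fun y => blockLogDet_le_sum_pathInc hρ y m k
  rw [integral_add' hS (hC (m - 1)), integral_shift_eq hμ pathCost_shift, hsum] at h2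
  rw [hsum] at h1
  rw [abs_of_nonneg (by linarith)]
  linarith

lemma tendsto_blockLogDet (hρ : 0 ≤ ρ) {y : ℤ → Mat N K × Mat N K} {I V : ℝ}
    (hI : HasWindowMean (fun n => pathInc ρ n y) I) (hV : HasWindowMean (fun n => pathCost ρ n y) V)
    (C : ℕ) :
    Tendsto (fun p : ℤ × ℤ => 1 / (((p.2 - p.1 + 1 : ℤ) : ℝ) * N) *
        blockLogDet ρ (fun n => (y n).1) (fun n => (y n).2) p.1 p.2)
      (longWindows ⊓ 𝓟 {p | |p.1| ≤ C * (p.2 - p.1)}) (𝓝 (1 / (N : ℝ) * I)) := by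
  refine tendsto_div_of_window_bound (S := fun p : ℤ × ℤ =>
    blockLogDet ρ (fun n => (y n).1) (fun n => (y n).2) p.1 p.2) inf_le_left fun ε hε => ?_
  -- the two errors below add up to `δ (2 |m| + k + 1)` up to constants, and `|m| ≤ C k`
  set δ := ε / (2 * C + 1) with hδ
  have hδ0 : 0 < δ := by positivity
  have hδε : δ * (2 * C + 1) = ε := by rw [hδ]; field_simp
  obtain ⟨B, hB⟩ := hI δ hδ0
  obtain ⟨B', hB'⟩ := hV.abs_sub_le hδ0
  refine ⟨B + B' + |V| + δ, ?_⟩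
  have hlen : ∀ᶠ p : ℤ × ℤ in longWindows, 0 ≤ p.2 - p.1 :=
    tendsto_comap.eventually_ge_atTop (0 : ℤ)
  rw [eventually_inf_principal]
  filter_upwards [hlen] with ⟨m, n⟩ hp hC
  simp only at hp hC ⊢
  obtain ⟨k, hk⟩ : ∃ k : ℕ, n - m + 1 = k := ⟨(n - m + 1).toNat, by omega⟩
  obtain rfl : n = m + k - 1 := by omega
  have h1 := sum_pathInc_le_blockLogDet hρ y m k
  have h2 := blockLogDet_le_sum_pathInc hρ y m k
  have h3 := abs_le.mp (hB m k)
  have h4 := abs_le.mp (hB' (m - 1))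
  have h5 : |((m - 1 : ℤ) : ℝ)| ≤ |(m : ℝ)| + 1 := by
    push_cast
    exact (abs_sub _ _).trans (by rw [abs_one])
  have h6 : |(m : ℝ)| ≤ C * k := by
    have hC' : |m| ≤ C * (k : ℤ) := by nlinarith [(Nat.cast_nonneg C : (0 : ℤ) ≤ C)]
    exact_mod_cast hC'
  have h7 := le_abs_self V
  rw [hk, Int.cast_natCast]
  have h8 : δ * |((m - 1 : ℤ) : ℝ)| ≤ δ * (C * k + 1) :=
    mul_le_mul_of_nonneg_left (h5.trans (by linarith)) hδ0.le
  have h9 : δ * (|(m : ℝ)| + k) ≤ δ * (C * k + k) :=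
    mul_le_mul_of_nonneg_left (by linarith) hδ0.le
  have h10 : ε * k = δ * (C * k + 1) + δ * (C * k + k) - δ := by rw [← hδε]; ring
  have h11 := pathCost_nonneg hρ (m - 1) y
  have h12 : 0 ≤ δ * (C * k + 1) := by positivity
  have h13 := abs_nonneg V
  have h14 : 0 ≤ B' + V := by
    have := hB' 0
    have h15 := abs_le.mp this
    have h16 := pathCost_nonneg hρ 0 y
    simp only [Int.cast_zero, abs_zero, mul_zero, zero_add] at h15
    linarith
  rw [abs_le]
  constructor <;> linarith

lemma tendsto_sumStep (hρ : 0 ≤ ρ) {y : ℤ → Mat N K × Mat N K} {I : ℝ}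
    (hI : HasWindowMean (fun n => pathInc ρ n y) I) {X : Mat K K} (hX : 0 ≤ X) :
    Tendsto (fun n : ℕ => 1 / ((n : ℝ) * N) *
      sumStep ρ (fun k => (y k).1) (fun k => (y k).2) X n) atTop (𝓝 (1 / (N : ℝ) * I)) := by
  set f : ℤ → Mat N K := fun k => (y (1 + k)).1 with hf
  set g : ℤ → Mat N K := fun k => (y (1 + k)).2 with hg
  set X₀ := recMap ρ (y 0).1 (y 0).2 X with hX₀
  have hX₀p : X₀.PosDef := recMap_posDef hρ _ _ hX
  have hW₀p : (pathSol ρ y 0).PosDef := pastLimit_posDef hρ _ _ 0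
  have hone : (0 : Mat K K) ≤ 1 := zero_le_one
  -- after one step both trajectories are compared with the trajectory started from `I`
  have hcmp : ∀ Z : Mat K K, Z.PosDef → Z ≤ 1 → ∀ k, sumStep ρ f g Z k ≤ sumStep ρ f g 1 k ∧
      sumStep ρ f g 1 k ≤ sumStep ρ f g Z k - logDet Z := fun Z hZ hZ1 k => by
    have h1 := sumStep_sub_le hρ f g hZ hZ1 k
    rw [logDet_one] at h1
    exact ⟨sumStep_mono hρ f g (Matrix.nonneg_iff_posSemidef.mpr hZ.posSemidef) hZ1 k,
      by linarith⟩
  have hstep : ∀ k, sumStep ρ (fun k => (y k).1) (fun k => (y k).2) X (k + 1) =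
      stepLogDet ρ (y 0).1 (y 0).2 X + sumStep ρ f g X₀ k := fun k => by
    rw [sumStep_succ', hf, hg]
    simp only [add_comm]
    rfl
  have hW : ∀ k, sumStep ρ f g (pathSol ρ y 0) k = ∑ j ∈ Finset.range k, pathInc ρ (1 + j) y :=
    fun k => by simpa using sumStep_pathSol hρ y 1 k
  have key : Tendsto (fun n : ℕ => sumStep ρ (fun k => (y k).1) (fun k => (y k).2) X n / n) atTop
      (𝓝 I) := by
    rw [← tendsto_add_atTop_iff_nat 1, Metric.tendsto_atTop]
    intro ε hε
    obtain ⟨B, hB⟩ := hI (ε / 2) (half_pos hε)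
    set E := |stepLogDet ρ (y 0).1 (y 0).2 X| + (-logDet X₀) + (-logDet (pathSol ρ y 0)) + |I| +
      B + ε with hE
    obtain ⟨n0, hn0⟩ := exists_nat_gt (E / (ε / 2))
    rw [div_lt_iff₀ (half_pos hε)] at hn0
    refine ⟨n0, fun k hk => ?_⟩
    have hk1 : (0 : ℝ) < ((k + 1 : ℕ) : ℝ) := by positivity
    have hkn : (n0 : ℝ) ≤ k := by exact_mod_cast hk
    have h1 := hcmp X₀ hX₀p (recMap_le_one hρ _ _ hX) k
    have h2 := hcmp _ hW₀p (pastLimit_le_one hρ _ _ 0) k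
    have h3 := abs_le.mp (hB 1 k)
    rw [← hW] at h3
    simp only [Int.cast_one, abs_one] at h3
    have h4 : sumStep ρ (fun k => (y k).1) (fun k => (y k).2) X (k + 1) / ((k + 1 : ℕ) : ℝ) - I =
        (stepLogDet ρ (y 0).1 (y 0).2 X + sumStep ρ f g X₀ k - (k + 1 : ℕ) * I) /
          ((k + 1 : ℕ) : ℝ) := by
      rw [hstep]; field_simp
    rw [Real.dist_eq, h4, abs_div, abs_of_pos hk1, div_lt_iff₀ hk1, abs_lt]
    have h5 := abs_le.mp (le_refl |stepLogDet ρ (y 0).1 (y 0).2 X|)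
    have h6 := abs_le.mp (le_refl |I|)
    have h7 : logDet X₀ ≤ 0 := logDet_recMap_nonpos hρ _ _ hX
    have h8 := pathCost_nonneg hρ 0 y
    have h9 : ε / 2 * n0 ≤ ε / 2 * k := mul_le_mul_of_nonneg_left hkn (by positivity)
    rw [pathCost] at h8
    push_cast
    constructor <;> nlinarith
  have := key.const_mul (1 / (N : ℝ))
  refine this.congr fun n => ?_
  rw [one_div_mul_eq_div, one_div_mul_eq_div, div_div]

end Channel


section Main

open scoped MatrixOrder

variable {Ω : Type*} [MeasurableSpace Ω] {P : Measure Ω} {N K : ℕ} {ρ : ℝ}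
  {F G : ℤ → Ω → Mat N K}

/-! ### Transfer to the probability space -/

/-- The sample path of the channel at `ω`. -/
def path (F G : ℤ → Ω → Mat N K) (ω : Ω) : ℤ → Mat N K × Mat N K := fun n => (F n ω, G n ω)

lemma measurable_path (h : IsErgodicChannel P F G) : Measurable (path F G) :=
  measurable_pi_lambda _ fun n => h.ergodic.measurable n

lemma ergodic_map_path (h : IsErgodicChannel P F G) : Ergodic (shift _) (P.map (path F G)) :=
  h.ergodic.ergodic

lemma integrable_map_path_fst (h : IsErgodicChannel P F G) :
    Integrable (fun y : ℤ → Mat N K × Mat N K => ‖(y 0).1‖ ^ 2) (P.map (path F G)) :=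
  (integrable_map_measure ((measurable_pi_apply 0).fst.norm.pow_const 2).aestronglyMeasurable
    (measurable_path h).aemeasurable).mpr h.moment_F

lemma integrable_map_path_snd (h : IsErgodicChannel P F G) :
    Integrable (fun y : ℤ → Mat N K × Mat N K => ‖(y 0).2‖ ^ 2) (P.map (path F G)) :=
  (integrable_map_measure ((measurable_pi_apply 0).snd.norm.pow_const 2).aestronglyMeasurable
    (measurable_path h).aemeasurable).mpr h.moment_G

lemma ae_hasWindowMean_path [IsProbabilityMeasure P] (h : IsErgodicChannel P F G)
    {u : ℤ → (ℤ → Mat N K × Mat N K) → ℝ} (hu : ∀ n y, u n (shift _ y) = u (n + 1) y)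
    (hm : Measurable (u 0)) (h0 : Integrable (u 0) (P.map (path F G))) :
    ∀ᵐ ω ∂P, HasWindowMean (fun n => u n (path F G ω)) (∫ y, u 0 y ∂(P.map (path F G))) := by
  have := Measure.isProbabilityMeasure_map (μ := P) (measurable_path h).aemeasurable
  exact ae_of_ae_map (measurable_path h).aemeasurable
    (ae_hasWindowMean (ergodic_map_path h) hu hm h0)

lemma ae_hasWindowMean_pathInc [IsProbabilityMeasure P] (hρ : 0 ≤ ρ)
    (h : IsErgodicChannel P F G) : ∀ᵐ ω ∂P, HasWindowMean
      (fun n => pathInc ρ n (path F G ω)) (∫ y, pathInc ρ 0 y ∂(P.map (path F G))) :=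
  ae_hasWindowMean_path h pathInc_shift (measurable_pathInc hρ 0)
    (integrable_pathInc hρ (integrable_map_path_fst h) (integrable_map_path_snd h))

/-- Every solution is almost surely the two-sided solution constructed on path space. -/
lemma ae_eq_pathSol [IsProbabilityMeasure P] (hρ : 0 ≤ ρ) (h : IsErgodicChannel P F G)
    {W : ℤ → Ω → Mat K K} (hW : IsStationarySolution P ρ F G W) :
    ∀ᵐ ω ∂P, ∀ n, W n ω = pathSol ρ (path F G ω) n := by
  have hsize := ae_hasWindowMean_path h (u := pathSize ρ) pathSize_shift (measurable_pathSize 0)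
    (((integrable_map_path_fst h).const_mul ρ).add ((integrable_map_path_snd h).const_mul ρ))
  filter_upwards [hsize, hW.recursion] with ω hω hrec n
  have hM : ∀ n : ℤ, ∃ k ≤ n,
      ρ * ‖F k ω‖ ^ 2 ≤ (∫ y, pathSize ρ 0 y ∂(P.map (path F G))) + 1 ∧
      ρ * ‖G k ω‖ ^ 2 ≤ (∫ y, pathSize ρ 0 y ∂(P.map (path F G))) + 1 := fun n => by
    obtain ⟨k, hk, hle⟩ := hω.exists_le n
    have hF : 0 ≤ ρ * ‖F k ω‖ ^ 2 := by positivity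
    have hG : 0 ≤ ρ * ‖G k ω‖ ^ 2 := by positivity
    simp only [pathSize, path] at hle
    exact ⟨k, hk, by simp only [pathSize]; linarith, by simp only [pathSize]; linarith⟩
  have hW0 : ∀ n, 0 ≤ W n ω := fun n =>
    Matrix.nonneg_iff_posSemidef.mpr (hW.posDef n ω).posSemidef
  have hS0 := pathSol_nonneg hρ (path F G ω)
  have hS := pathSol_eq_recMap hρ (path F G ω)
  exact le_antisymm
    (solution_le_solution (f := fun k => F k ω) (g := fun k => G k ω) (W := fun k => W k ω)
      hρ hW0 hS0 hrec hS hM n)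
    (solution_le_solution (f := fun k => F k ω) (g := fun k => G k ω) (W' := fun k => W k ω)
      hρ hS0 hW0 hS hrec hM n)

lemma measurable_pathSol_pi (hρ : 0 ≤ ρ) :
    Measurable (pathSol ρ : (ℤ → Mat N K × Mat N K) → ℤ → Mat K K) :=
  measurable_pi_lambda _ fun n => measurable_pathSol hρ n

/-- The law of the two-sided solution is a factor of the law of the channel. -/
lemma ergodic_pathLaw_of_ae_eq (hρ : 0 ≤ ρ) (h : IsErgodicChannel P F G)
    {W : ℤ → Ω → Mat K K} (hW : ∀ᵐ ω ∂P, ∀ n, W n ω = pathSol ρ (path F G ω) n) :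
    Ergodic (shift (Mat K K)) (pathLaw P W) := by
  have hlaw : pathLaw P W = (P.map (path F G)).map (pathSol ρ) := by
    rw [Measure.map_map (measurable_pathSol_pi hρ) (measurable_path h), pathLaw]
    exact Measure.map_congr (hW.mono fun ω hω => funext hω)
  have hmp : MeasurePreserving (pathSol ρ) (P.map (path F G)) (pathLaw P W) :=
    ⟨measurable_pathSol_pi hρ, hlaw.symm⟩
  exact hmp.ergodic_of_ergodic_semiconj (ergodic_map_path h)
    (shiftEquiv (Mat K K)).measurable fun y => funext fun n => pathSol_shift y n

lemma isStationarySolution_pathSol (hρ : 0 ≤ ρ) (h : IsErgodicChannel P F G) :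
    IsStationarySolution P ρ F G fun n ω => pathSol ρ (path F G ω) n where
  stationary :=
    { measurable := fun n => (measurable_pathSol hρ n).comp (measurable_path h)
      measurePreserving :=
        (ergodic_pathLaw_of_ae_eq hρ h (Eventually.of_forall fun _ _ => rfl)).toMeasurePreserving }
  posDef := fun n _ => pastLimit_posDef hρ _ _ n
  recursion := Eventually.of_forall fun _ => pathSol_eq_recMap hρ _

lemma isMutualInformation_pathInc [IsProbabilityMeasure P] (hρ : 0 ≤ ρ)
    (h : IsErgodicChannel P F G) :
    IsMutualInformation P ρ F G (1 / (N : ℝ) * ∫ y, pathInc ρ 0 y ∂(P.map (path F G))) := by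
  have hF := integrable_map_path_fst h
  have hG := integrable_map_path_snd h
  have hmp := (ergodic_map_path h).toMeasurePreserving
  have hpm := (measurable_path h).aemeasurable (μ := P)
  have hcost := ae_hasWindowMean_path h (u := pathCost ρ) pathCost_shift (measurable_pathCost hρ 0)
    (integrable_pathCost hρ hG)
  refine ⟨?_, fun m n hmn => ?_, ?_⟩
  · filter_upwards [ae_hasWindowMean_pathInc hρ h, hcost] with ω h1 h2 C
    exact tendsto_blockLogDet hρ h1 h2 C
  · obtain ⟨k, hk⟩ : ∃ k : ℕ, n - m + 1 = k := ⟨(n - m + 1).toNat, by omega⟩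
    obtain rfl : n = m + k - 1 := by omega
    exact (integrable_blockLogDet hρ hmp hF hG m k).comp_measurable (measurable_path h)
  · refine tendsto_div_of_window_bound le_rfl (S := fun p : ℤ × ℤ =>
      ∫ ω, blockLogDet ρ (fun n => F n ω) (fun n => G n ω) p.1 p.2 ∂P) fun ε hε =>
      ⟨∫ y, pathCost ρ 0 y ∂(P.map (path F G)), ?_⟩
    have hlen : ∀ᶠ p : ℤ × ℤ in longWindows, 0 ≤ p.2 - p.1 :=
      tendsto_comap.eventually_ge_atTop (0 : ℤ)
    filter_upwards [hlen] with ⟨m, n⟩ hp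
    simp only at hp ⊢
    obtain ⟨k, hk⟩ : ∃ k : ℕ, n - m + 1 = k := ⟨(n - m + 1).toNat, by omega⟩
    obtain rfl : n = m + k - 1 := by omega
    have h1 := abs_integral_blockLogDet_sub_le hρ hmp hF hG m k
    rw [integral_map hpm (measurable_blockLogDet hρ m k).aestronglyMeasurable] at h1
    rw [hk, Int.cast_natCast]
    have h2 : 0 ≤ ε * (k : ℝ) := by positivity
    exact h1.trans (le_add_of_nonneg_left h2)

end Main

end ErgodicChannel

theorem theorem1 {Ω : Type*} [MeasurableSpace Ω] (P : Measure Ω) [IsProbabilityMeasure P]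
    (N K : ℕ) (hN : 0 < N) (hK : 0 < K) (ρ : ℝ) (hρ : 0 < ρ)
    (F G : ℤ → Ω → ErgodicChannel.Mat N K)
    (hFG : ErgodicChannel.IsErgodicChannel P F G) :
    ((∃ W, ErgodicChannel.IsStationarySolution P ρ F G W) ∧
      (∀ W W', ErgodicChannel.IsStationarySolution P ρ F G W →
        ErgodicChannel.IsStationarySolution P ρ F G W' →
          ∀ᵐ ω ∂P, ∀ n, W n ω = W' n ω) ∧
      (∀ W, ErgodicChannel.IsStationarySolution P ρ F G W →
        ErgodicChannel.IsErgodicProcess P W)) ∧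
    ∃ I : ℝ, ErgodicChannel.IsMutualInformation P ρ F G I ∧
      (∀ W, ErgodicChannel.IsStationarySolution P ρ F G W →
        Integrable (fun ω =>
          ErgodicChannel.logDet (ErgodicChannel.innerMat ρ (F 0 ω) (W (-1) ω))) P ∧
        Integrable (fun ω => ErgodicChannel.logDet (W 0 ω)) P ∧
        I = 1 / (N : ℝ) *
          ((∫ ω, ErgodicChannel.logDet (ErgodicChannel.innerMat ρ (F 0 ω) (W (-1) ω)) ∂P) -
            ∫ ω, ErgodicChannel.logDet (W 0 ω) ∂P)) ∧
      (∀ X : ErgodicChannel.Mat K K, X.PosSemidef →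
        ∀ᵐ ω ∂P, Tendsto (fun n : ℕ => 1 / ((n : ℝ) * N) *
          ∑ ℓ ∈ Finset.range n,
            (ErgodicChannel.logDet (ErgodicChannel.innerMat ρ (F ℓ ω)
                (ErgodicChannel.recursionFrom ρ (fun k => F k ω) (fun k => G k ω) X ℓ)) -
              ErgodicChannel.logDet
                (ErgodicChannel.recursionFrom ρ (fun k => F k ω) (fun k => G k ω) X (ℓ + 1))))
          atTop (𝓝 I)) := by
  open ErgodicChannel in
  refine ⟨⟨⟨_, isStationarySolution_pathSol hρ.le hFG⟩, fun W W' hW hW' => ?_, fun W hW => ?_⟩,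
    _, isMutualInformation_pathInc hρ.le hFG, fun W hW => ?_, fun X hX => ?_⟩
  · filter_upwards [ae_eq_pathSol hρ.le hFG hW, ae_eq_pathSol hρ.le hFG hW'] with ω h1 h2 n
    rw [h1, h2]
  · exact ⟨hW.stationary.measurable,
      ergodic_pathLaw_of_ae_eq hρ.le hFG (ae_eq_pathSol hρ.le hFG hW)⟩
  · have hWae := ae_eq_pathSol hρ.le hFG hW
    have hF := integrable_map_path_fst hFG
    have hG := integrable_map_path_snd hFG
    have hpath := measurable_path hFG
    have hI := integrable_logDet_innerMat hρ.le hF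
    have hV : Integrable (fun y => logDet (pathSol ρ y 0)) (P.map (path F G)) := by
      refine (integrable_pathCost hρ.le hG).neg.congr (Eventually.of_forall fun y => ?_)
      simp [pathCost]
    have e1 : (fun ω => logDet (innerMat ρ (F 0 ω) (W (-1) ω))) =ᵐ[P]
        fun ω => logDet (innerMat ρ (path F G ω 0).1 (pathSol ρ (path F G ω) (-1))) :=
      hWae.mono fun ω hω => by simp only [hω, path]
    have e2 : (fun ω => logDet (W 0 ω)) =ᵐ[P] fun ω => logDet (pathSol ρ (path F G ω) 0) :=
      hWae.mono fun ω hω => by simp only [hω]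
    refine ⟨(hI.comp_measurable hpath).congr e1.symm, (hV.comp_measurable hpath).congr e2.symm, ?_⟩
    rw [integral_congr_ae e1, integral_congr_ae e2, integral_pathInc hρ.le hF hG,
      integral_map hpath.aemeasurable hI.aestronglyMeasurable,
      integral_map hpath.aemeasurable hV.aestronglyMeasurable]
  · filter_upwards [ae_hasWindowMean_pathInc hρ.le hFG] with ω hω
    exact tendsto_sumStep hρ.le hω (Matrix.nonneg_iff_posSemidef.mpr hX)
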